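/- Conventions. A tracial von Neumann algebra $(M,\tau)$ is a von Neumann algebra with a normal semifinite faithful trace. If $J:(\mathcal M,\tau_{\mathcal M})\to(M,\tau_M)$ is a normal unital trace preserving $*$-homomorphism, $\mathbb E_J:M\to\mathcal M$ denotes the associated conditional expectation, i.e. the adjoint of the isometry $L^1(\mathcal M,\tau_{\mathcal M})\to L^1(M,\tau_M)$ induced by $J$; equivalently $\tau_{\mathcal M}(\mathbb E_J(y)x)=\tau_M(yJ(x))$ for all $y\in M$ and all $x\in\mathcal M$ in the span of the positive elements of finite trace. A map $T:\mathcal M\to\mathcal M$ *admits an absolute dilation* if there are a tracial von Neumann algebra $(M,\tau_M)$, a normal unital trace preserving $*$-homomorphism $J:\mathcal M\to M$ and a trace preserving $*$-automorphism $U$ of $M$ with $T^k=\mathbb E_JU^kJ$ for all $k\ge 0$. When $\tau_{\mathcal M}$ is a state, a normal unital completely positive (ucp) trace preserving map $T:\mathcal M\to\mathcal M$ is *factorizable* if there are a tracial von Neumann algebra $(M,\tau_M)$ and normal unital trace preserving $*$-homomorphisms $J,J':\mathcal M\to M$ with $T=\mathbb E_J\circ J'$. Let $\lambda$ be the left regular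 representation of $S_3$ on $\ell^2_{S_3}$, and $VN(S_3)\subseteq B(\ell^2_{S_3})$ the von Neumann algebra it generates, with the trace $\tau(x)=\langle x\delta_e,\delta_e\rangle$; $M_u$ is the normal linear map on $VN(S_3)$ with $M_u(\lambda(t))=u(t)\lambda(t)$ for all $t\in S_3$. Permutations are composed from right to left. Theorem. Let $u:S_3\to\mathbb C$ be the function $$u(1)=1,\quad u(123)=-\tfrac12+\tfrac{i}{2\sqrt3},\quad u(132)=-\tfrac12-\tfrac{i}{2\sqrt3},\quad u(12)=u(31)=-\tfrac{\sqrt2}{3},\quad u(23)=\tfrac{2\sqrt2}{3}.$$ 1. The Fourier multiplier $M_u:VN(S_3)\to VN(S_3)$ exists, is unique, and is unital completely positive, but it does not admit any absolute dilation. 2. The $6\times6$ matrix $A=[u(st^{-1})]_{s,t\in S_3}$ has rank $2$, and there are $\varphi_1,\varphi_2\in\mathbb C^{S_3}$ such that $A_{s,t}=\sum_{k=1}^2\overline{\varphi_k(s)}\,\varphi_k(t)$ for all $s,t\in S_3$ and the four vectors $\overline{\varphi_k}\,\varphi_l\in\mathbb C^{S_3}$ (pointwise products), $1\le k,l\le2$,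 are linearly independent. 3. The Schur multiplier $[x_{s,t}]\mapsto[u(st^{-1})x_{s,t}]$ on $B(\ell^2_{S_3})$, equipped with its normalized trace, is normal, ucp and trace preserving, but not factorizable. -/

import Mathlib

open scoped ENNReal NNReal ComplexOrder
open Equiv (Perm)

universe w

noncomputable section

/-! ### Von Neumann algebras, traces and normal completely positive maps

Von Neumann algebras are Mathlib's `VonNeumannAlgebra H`: unital `*`-subalgebras of `B(H)` equal to
their bicommutant.  Their elements are ordered as operators on `H` (Loewner order). -/

namespace VNDil

instance instSMulMem {H : Type*} [NormedAddCommGroup H] [InnerProductSpace ℂ H] [CompleteSpace H] :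
    SMulMemClass (VonNeumannAlgebra H) ℂ (H →L[ℂ] H) where
  smul_mem {M} c _ hx := M.toStarSubalgebra.smul_mem hx c

section General

variable {H : Type*} [NormedAddCommGroup H] [InnerProductSpace ℂ H] [CompleteSpace H]
variable {K : Type*} [NormedAddCommGroup K] [InnerProductSpace ℂ K] [CompleteSpace K]

/-- `τ` is a normal semifinite faithful trace on (the positive cone of) `M`.  Only the values of
`τ` at positive elements matter. -/
structure IsNSFTrace (M : VonNeumannAlgebra H) (τ : M → ℝ≥0∞) : Prop where
  map_add : ∀ x y : M, 0 ≤ x → 0 ≤ y → τ (x + y) = τ x + τ y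
  map_smul : ∀ (r : ℝ≥0) (x : M), 0 ≤ x → τ (((r : ℝ) : ℂ) • x) = r * τ x
  tracial : ∀ x : M, τ (star x * x) = τ (x * star x)
  faithful : ∀ x : M, 0 ≤ x → τ x = 0 → x = 0
  semifinite : ∀ x : M, 0 ≤ x → x ≠ 0 → ∃ y : M, 0 ≤ y ∧ y ≤ x ∧ y ≠ 0 ∧ τ y < ∞
  normal : ∀ (S : Set M) (x : M), S.Nonempty → (∀ s ∈ S, 0 ≤ s) → DirectedOn (· ≤ ·) S →
    IsLUB S x → IsLUB (τ '' S) (τ x)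

/-- The extension of a trace `τ` to its definition ideal: `x` is a linear combination of positive
elements of finite trace, and the corresponding combination of their traces is `z`. -/
def HasTrace {M : VonNeumannAlgebra H} (τ : M → ℝ≥0∞) (x : M) (z : ℂ) : Prop :=
  ∃ a b c d : M, (0 ≤ a ∧ τ a < ∞) ∧ (0 ≤ b ∧ τ b < ∞) ∧ (0 ≤ c ∧ τ c < ∞) ∧ (0 ≤ d ∧ τ d < ∞) ∧
    x = (a - b) + Complex.I • (c - d) ∧
    z = (((τ a).toReal - (τ b).toReal : ℝ) : ℂ) +
      Complex.I * (((τ c).toReal - (τ d).toReal : ℝ) : ℂ)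

/-- The `σ`-weak (ultraweak, `w*`-) topology of `M ⊆ B(H)`: the weakest topology for which all
functionals `x ↦ ∑ₙ ⟪ξₙ, x ηₙ⟫` with `∑ ‖ξₙ‖² < ∞` and `∑ ‖ηₙ‖² < ∞` are continuous. -/
abbrev sigmaWeak (M : VonNeumannAlgebra H) : TopologicalSpace M :=
  ⨅ (ξ : lp (fun _ : ℕ => H) 2) (η : lp (fun _ : ℕ => H) 2),
    TopologicalSpace.induced
      (fun x : M => ∑' n, inner ℂ (ξ n) ((x : H →L[ℂ] H) (η n))) inferInstance

/-- Normality of a map between von Neumann algebras: `w*`-continuity. -/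
def IsNormalMap {M : VonNeumannAlgebra H} {N : VonNeumannAlgebra K} (T : M → N) : Prop :=
  @Continuous M N (sigmaWeak M) (sigmaWeak N) T

/-- Positivity of a matrix `[x i j]` over `M ⊆ B(H)`, as an operator on `Hⁿ`. -/
def MatrixPos {M : VonNeumannAlgebra H} {n : ℕ} (x : Matrix (Fin n) (Fin n) M) : Prop :=
  ∀ ξ : Fin n → H, 0 ≤ ∑ i, ∑ j, inner ℂ (ξ i) ((x i j : H →L[ℂ] H) (ξ j))

/-- Unital completely positive maps. -/
structure IsUCP {M : VonNeumannAlgebra H} {N : VonNeumannAlgebra K} (T : M →ₗ[ℂ] N) : Prop where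
  unital : T 1 = 1
  completelyPositive : ∀ (n : ℕ) (x : Matrix (Fin n) (Fin n) M), MatrixPos x → MatrixPos (x.map T)

/-- `T` is trace preserving: `σ ∘ T = τ` on the positive cone. -/
def TracePreserving {M : VonNeumannAlgebra H} {N : VonNeumannAlgebra K}
    (τ : M → ℝ≥0∞) (σ : N → ℝ≥0∞) (T : M → N) : Prop :=
  ∀ x : M, 0 ≤ x → σ (T x) = τ x

/-- `E : N → M` is the conditional expectation associated with the trace preserving
`*`-homomorphism `J : M → N`, i.e. the adjoint of the isometry `L¹(M, τ) → L¹(N, σ)` induced by `J`,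
for the duality pairing `⟨x, y⟩ = τ(x y)` between `M` and `L¹(M, τ)`.  It is tested on the dense
subspace of `L¹(M, τ)` spanned by the positive elements of finite trace, where it says
`τ(E(y) x) = σ(y J(x))`. -/
def IsCondExp {M : VonNeumannAlgebra H} {N : VonNeumannAlgebra K}
    (τ : M → ℝ≥0∞) (σ : N → ℝ≥0∞) (J : M →⋆ₐ[ℂ] N) (E : N →ₗ[ℂ] M) : Prop :=
  ∀ (y : N) (x : M), 0 ≤ x → τ x < ∞ →
    ∃ z : ℂ, HasTrace τ (E y * x) z ∧ HasTrace σ (y * J x) z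

end General

/-- `T : M → M` admits an absolute dilation (through a von Neumann algebra `N` acting on a
Hilbert space in the universe `w`): `Tᵏ = E_J Uᵏ J` for all `k ≥ 0`. -/
def AbsolutelyDilatable {H : Type*} [NormedAddCommGroup H] [InnerProductSpace ℂ H] [CompleteSpace H]
    {M : VonNeumannAlgebra H} (τ : M → ℝ≥0∞) (T : M →ₗ[ℂ] M) : Prop :=
  ∃ (K : Type w) (_ : NormedAddCommGroup K) (_ : InnerProductSpace ℂ K) (_ : CompleteSpace K)
    (N : VonNeumannAlgebra K) (σ : N → ℝ≥0∞) (J : M →⋆ₐ[ℂ] N) (U : N ≃⋆ₐ[ℂ] N) (E : N →ₗ[ℂ] M),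
    IsNSFTrace N σ ∧ IsNormalMap J ∧ TracePreserving τ σ J ∧ TracePreserving σ σ U ∧
    IsCondExp τ σ J E ∧ ∀ (k : ℕ) (x : M), T^[k] x = E (U^[k] (J x))

/-- `T : M → M` is factorizable (through a von Neumann algebra `N` acting on a Hilbert space in the
universe `w`): `T = E_J ∘ J'`. -/
def Factorizable {H : Type*} [NormedAddCommGroup H] [InnerProductSpace ℂ H] [CompleteSpace H]
    {M : VonNeumannAlgebra H} (τ : M → ℝ≥0∞) (T : M →ₗ[ℂ] M) : Prop :=
  ∃ (K : Type w) (_ : NormedAddCommGroup K) (_ : InnerProductSpace ℂ K) (_ : CompleteSpace K)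
    (N : VonNeumannAlgebra K) (σ : N → ℝ≥0∞) (J J' : M →⋆ₐ[ℂ] N) (E : N →ₗ[ℂ] M),
    IsNSFTrace N σ ∧ IsNormalMap J ∧ TracePreserving τ σ J ∧
    IsNormalMap J' ∧ TracePreserving τ σ J' ∧ IsCondExp τ σ J E ∧ ∀ x : M, T x = E (J' x)

/-! ### Fourier multipliers on a finite group -/

section Fourier

variable (G : Type*) [Group G] [Fintype G]

/-- The left regular representation on `ℓ²(G)`: `(λ(s) h)(t) = h(s⁻¹ t)`. -/
def leftReg (s : G) : EuclideanSpace ℂ G →L[ℂ] EuclideanSpace ℂ G :=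
  (LinearIsometryEquiv.piLpCongrLeft 2 ℂ ℂ (Equiv.mulLeft s)).toContinuousLinearEquiv

theorem leftReg_apply (s : G) (h : EuclideanSpace ℂ G) (t : G) :
    leftReg G s h t = h (s⁻¹ * t) := rfl

/-- The group von Neumann algebra `VN(G)`, the von Neumann algebra generated by the `λ(s)`. -/
def groupVN : VonNeumannAlgebra (EuclideanSpace ℂ G) where
  toStarSubalgebra := StarSubalgebra.centralizer ℂ
    (StarSubalgebra.centralizer ℂ (Set.range (leftReg G)) :
      Set (EuclideanSpace ℂ G →L[ℂ] EuclideanSpace ℂ G))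
  centralizer_centralizer' := by
    simp

theorem leftReg_mem (s : G) : leftReg G s ∈ groupVN G := by
  change leftReg G s ∈ StarSubalgebra.centralizer ℂ _
  rw [StarSubalgebra.mem_centralizer_iff]
  intro x hx
  have hx' := hx
  rw [SetLike.mem_coe, StarSubalgebra.mem_centralizer_iff] at hx
  have hs := star_mem hx'
  rw [StarSubalgebra.mem_centralizer_iff] at hs
  exact ⟨((hx _ ⟨s, rfl⟩).1).symm, ((hs _ ⟨s, rfl⟩).1).symm⟩

/-- `λ(s)` as an element of `VN(G)`. -/
def lam (s : G) : groupVN G := ⟨leftReg G s, leftReg_mem G s⟩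

/-- The Plancherel trace of `VN(G)`, for the counting measure: `τ(x) = ⟪δ_e, x δ_e⟫`. -/
def plancherel [DecidableEq G] (x : groupVN G) : ℝ≥0∞ :=
  ENNReal.ofReal (inner ℂ (EuclideanSpace.single (1 : G) (1 : ℂ))
    ((x : EuclideanSpace ℂ G →L[ℂ] EuclideanSpace ℂ G) (EuclideanSpace.single 1 1))).re

variable {G} in
/-- `T` is the Fourier multiplier `M_u` on `VN(G)`: the normal linear map with
`T (λ(t)) = u(t) λ(t)`. -/
structure IsFourierMultiplier (u : G → ℂ) (T : groupVN G →ₗ[ℂ] groupVN G) : Prop where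
  normal : IsNormalMap T
  apply_lam : ∀ t : G, T (lam G t) = u t • lam G t

end Fourier

/-! ### Schur multipliers on a finite index set -/

section Schur

variable (I : Type*) [Fintype I] [DecidableEq I]

/-- `B(ℓ²_I)` as a von Neumann algebra. -/
def fullVN : VonNeumannAlgebra (EuclideanSpace ℂ I) where
  toStarSubalgebra := ⊤
  centralizer_centralizer' :=
    Set.eq_univ_of_univ_subset Set.subset_centralizer_centralizer

variable {I}

/-- The `(i, j)` matrix entry of an operator on `ℓ²_I`. -/
def entry (x : fullVN I) (i j : I) : ℂ :=
  ((x : EuclideanSpace ℂ I →L[ℂ] EuclideanSpace ℂ I) (EuclideanSpace.single j 1)) i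

/-- The normalized trace `τ(x) = |I|⁻¹ ∑ x_{ii}` of `B(ℓ²_I)`. -/
def normTrace (x : fullVN I) : ℝ≥0∞ :=
  ENNReal.ofReal ((Fintype.card I : ℝ)⁻¹ * ∑ i, (entry x i i).re)

/-- `T` is the Schur multiplier with symbol `φ`: `T [x_{ij}] = [φ(i,j) x_{ij}]`. -/
def IsSchurMultiplier (φ : I → I → ℂ) (T : fullVN I →ₗ[ℂ] fullVN I) : Prop :=
  ∀ (x : fullVN I) (i j : I), entry (T x) i j = φ i j * entry x i j

end Schur

/-! ### The two traces are normal, semifinite and faithful -/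

section TraceFacts

variable {H : Type*} [NormedAddCommGroup H] [InnerProductSpace ℂ H] [FiniteDimensional ℂ H]
  [CompleteSpace H]

/-- In finite dimension, a faithful tracial positive functional is a normal semifinite faithful
trace. -/
theorem isNSFTrace_of_finite (M : VonNeumannAlgebra H) (f : (H →L[ℂ] H) →ₗ[ℝ] ℝ)
    (hpos : ∀ x : M, 0 ≤ x → 0 ≤ f x) (htr : ∀ x : M, f (star x * x : M) = f (x * star x : M))
    (hfaith : ∀ x : M, 0 ≤ x → f x = 0 → x = 0) :
    IsNSFTrace M (fun x => ENNReal.ofReal (f x)) where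
  map_add x y hx hy := by
    rw [← ENNReal.ofReal_add (hpos x hx) (hpos y hy)]
    congr 1
    exact map_add f _ _
  map_smul r x hx := by
    have h1 : (((((r : ℝ) : ℂ) • x : M)) : H →L[ℂ] H) = (r : ℝ) • (x : H →L[ℂ] H) := by
      ext v; simp
    rw [h1, f.map_smul, smul_eq_mul, ENNReal.ofReal_mul r.coe_nonneg, ENNReal.ofReal_coe_nnreal]
  tracial x := by simp only [htr x]
  faithful x hx h := hfaith x hx (le_antisymm (ENNReal.ofReal_eq_zero.1 h) (hpos x hx))
  semifinite x hx h0 := ⟨x, hx, le_rfl, h0, ENNReal.ofReal_lt_top⟩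
  normal S x hne hS hdir hx := by
    have hmono : ∀ a b : M, a ≤ b → f a ≤ f b := by
      intro a b hab
      have h := hpos (b - a) (by
        change (0 : H →L[ℂ] H) ≤ (b : H →L[ℂ] H) - a
        exact sub_nonneg.2 hab)
      have h2 : f ((b - a : M) : H →L[ℂ] H) = f b - f a := map_sub f _ _
      linarith
    refine ⟨?_, ?_⟩
    · rintro _ ⟨s, hs, rfl⟩
      exact ENNReal.ofReal_le_ofReal (hmono s x (hx.1 hs))
    intro B hB
    have : FiniteDimensional ℝ (H →L[ℂ] H) := FiniteDimensional.complexToReal _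
    have hfc : Continuous f := f.continuous_of_finiteDimensional
    have : Nonempty S := hne.to_subtype
    have hd : IsDirectedOrder S := ⟨fun a b => by
      obtain ⟨c, hc, h1, h2⟩ := hdir a a.2 b b.2
      exact ⟨⟨c, hc⟩, h1, h2⟩⟩
    let F : Filter (H →L[ℂ] H) := Filter.map (fun s : S => ((s : M) : H →L[ℂ] H)) Filter.atTop
    have hFne : F.NeBot := Filter.map_neBot
    have : ProperSpace (H →L[ℂ] H) := FiniteDimensional.proper_real _
    have hK : IsCompact (Metric.closedBall (0 : H →L[ℂ] H) ‖(x : H →L[ℂ] H)‖) :=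
      isCompact_closedBall _ _
    have hFK : F ≤ Filter.principal (Metric.closedBall (0 : H →L[ℂ] H) ‖(x : H →L[ℂ] H)‖) := by
      rw [Filter.le_principal_iff]
      refine Filter.mem_map.2 (Filter.univ_mem' fun s => ?_)
      simp only [Set.mem_preimage, mem_closedBall_zero_iff]
      exact CStarAlgebra.norm_le_norm_of_nonneg_of_le (hS s s.2) (hx.1 s.2)
    obtain ⟨y, -, hy⟩ := hK hFK
    have key : ∀ C : Set (H →L[ℂ] H), IsClosed C →
        (∀ᶠ s : S in Filter.atTop, ((s : M) : H →L[ℂ] H) ∈ C) → y ∈ C := by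
      intro C hC h
      exact isClosed_iff_clusterPt.1 hC y (hy.mono (Filter.le_principal_iff.2 (Filter.mem_map.2 h)))
    have hyM : y ∈ M := by
      have hcl : IsClosed (M : Set (H →L[ℂ] H)) :=
        (Submodule.closed_of_finiteDimensional
          (Subalgebra.toSubmodule M.toStarSubalgebra.toSubalgebra) :)
      exact key _ hcl (Filter.univ_mem' fun s => (s : M).2)
    have hub : ∀ s ∈ S, s ≤ (⟨y, hyM⟩ : M) := by
      intro s hs
      exact key (Set.Ici (s : H →L[ℂ] H)) isClosed_Ici
        (Filter.mem_of_superset (Filter.Ici_mem_atTop (⟨s, hs⟩ : S)) fun t ht => ht)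
    have hle : x ≤ ⟨y, hyM⟩ := hx.2 hub
    have hB' : ENNReal.ofReal (f y) ≤ B :=
      key {z | ENNReal.ofReal (f z) ≤ B}
        (isClosed_Iic.preimage (ENNReal.continuous_ofReal.comp hfc))
        (Filter.univ_mem' fun s => hB ⟨s, s.2, rfl⟩)
    exact (ENNReal.ofReal_le_ofReal (hmono x ⟨y, hyM⟩ hle)).trans hB'

end TraceFacts

theorem apply_eq_zero_of_nonneg {H : Type*} [NormedAddCommGroup H] [InnerProductSpace ℂ H]
    [CompleteSpace H] (x : H →L[ℂ] H) (hx : 0 ≤ x) (v : H) (h : (inner ℂ v (x v)).re = 0) :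
    x v = 0 := by
  obtain ⟨y, rfl⟩ := (CStarAlgebra.nonneg_iff_eq_star_mul_self).1 hx
  have h2 : (inner ℂ v ((star y * y) v)).re = ‖y v‖ ^ 2 := by
    rw [mul_apply_eq_comp, ContinuousLinearMap.star_eq_adjoint,
      ContinuousLinearMap.adjoint_inner_right, inner_self_eq_norm_sq_to_K]
    norm_cast
  rw [h2] at h
  have : y v = 0 := by simpa using h
  simp [this]

theorem re_inner_nonneg {H : Type*} [NormedAddCommGroup H] [InnerProductSpace ℂ H]
    [CompleteSpace H] (x : H →L[ℂ] H) (hx : 0 ≤ x) (v : H) : 0 ≤ (inner ℂ v (x v)).re := by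
  rw [ContinuousLinearMap.nonneg_iff_isPositive] at hx
  exact hx.re_inner_nonneg_right v

/-- The functional `x ↦ Re ⟪v, x v⟫`. -/
def vecState {H : Type*} [NormedAddCommGroup H] [InnerProductSpace ℂ H] (v : H) :
    (H →L[ℂ] H) →ₗ[ℝ] ℝ where
  toFun x := (inner ℂ v (x v)).re
  map_add' x y := by simp
  map_smul' r x := by simp [inner_smul_right_eq_smul]

theorem vecState_star_mul {H : Type*} [NormedAddCommGroup H] [InnerProductSpace ℂ H]
    [CompleteSpace H] (v : H) (x : H →L[ℂ] H) : vecState v (star x * x) = ‖x v‖ ^ 2 := by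
  change (inner ℂ v ((star x * x) v)).re = _
  rw [mul_apply_eq_comp, ContinuousLinearMap.star_eq_adjoint,
    ContinuousLinearMap.adjoint_inner_right, inner_self_eq_norm_sq_to_K]
  norm_cast

/-- Elements of `VN(G)` are left convolution operators. -/
theorem groupVN_entry {G : Type*} [Group G] [Fintype G] [DecidableEq G] (x : groupVN G) (s t : G) :
    ((x : EuclideanSpace ℂ G →L[ℂ] EuclideanSpace ℂ G) (EuclideanSpace.single t 1)) s =
    ((x : EuclideanSpace ℂ G →L[ℂ] EuclideanSpace ℂ G) (EuclideanSpace.single 1 1)) (s * t⁻¹) := by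
  let R : EuclideanSpace ℂ G →L[ℂ] EuclideanSpace ℂ G :=
    (LinearIsometryEquiv.piLpCongrLeft 2 ℂ ℂ (Equiv.mulRight t)).toContinuousLinearEquiv
  have hR : ∀ (h : EuclideanSpace ℂ G) (s : G), R h s = h (s * t⁻¹) := fun h s => rfl
  have hstar : ∀ g : G, star (leftReg G g) = leftReg G g⁻¹ := by
    intro g
    rw [ContinuousLinearMap.star_eq_adjoint]
    symm
    rw [ContinuousLinearMap.eq_adjoint_iff]
    intro a b
    simp only [PiLp.inner_apply, leftReg_apply]
    refine Fintype.sum_equiv (Equiv.mulLeft g) _ _ fun i => ?_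
    simp
  have hmem : R ∈ (StarSubalgebra.centralizer ℂ (Set.range (leftReg G))) := by
    rw [StarSubalgebra.mem_centralizer_iff]
    rintro _ ⟨g, rfl⟩
    rw [hstar]
    constructor <;> (ext h i; simp [hR, leftReg_apply, mul_assoc])
  have hx := x.2
  change (x : EuclideanSpace ℂ G →L[ℂ] EuclideanSpace ℂ G) ∈ StarSubalgebra.centralizer ℂ _ at hx
  rw [StarSubalgebra.mem_centralizer_iff] at hx
  have h1 := (hx R hmem).1
  have h2 : R (EuclideanSpace.single 1 1) = EuclideanSpace.single t 1 := by
    ext i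
    rw [hR]
    simp [mul_inv_eq_one]
  rw [← h2, ← hR, ← mul_apply_eq_comp, ← mul_apply_eq_comp, h1]

theorem plancherel_isNSFTrace (G : Type*) [Group G] [Fintype G] [DecidableEq G] :
    IsNSFTrace (groupVN G) (plancherel G) := by
  refine isNSFTrace_of_finite (groupVN G) (vecState (EuclideanSpace.single (1 : G) (1 : ℂ)))
    (fun x hx => re_inner_nonneg _ hx _) ?_ ?_
  · intro x
    have e1 := vecState_star_mul (EuclideanSpace.single (1 : G) (1 : ℂ))
      (x : EuclideanSpace ℂ G →L[ℂ] EuclideanSpace ℂ G)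
    have e2 := vecState_star_mul (EuclideanSpace.single (1 : G) (1 : ℂ))
      (star x : EuclideanSpace ℂ G →L[ℂ] EuclideanSpace ℂ G)
    rw [star_star] at e2
    refine e1.trans (Eq.trans ?_ e2.symm)
    rw [EuclideanSpace.norm_sq_eq, EuclideanSpace.norm_sq_eq]
    refine Fintype.sum_equiv (Equiv.inv G) _ _ fun t => ?_
    have h3 : (star x : EuclideanSpace ℂ G →L[ℂ] EuclideanSpace ℂ G)
        (EuclideanSpace.single 1 1) t⁻¹ = star ((x : EuclideanSpace ℂ G →L[ℂ] EuclideanSpace ℂ G)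
        (EuclideanSpace.single 1 1) t) := by
      have h4 := ContinuousLinearMap.adjoint_inner_right
        (x : EuclideanSpace ℂ G →L[ℂ] EuclideanSpace ℂ G)
        (EuclideanSpace.single t⁻¹ 1) (EuclideanSpace.single 1 1)
      rw [EuclideanSpace.inner_single_left, EuclideanSpace.inner_single_right,
        groupVN_entry] at h4
      simpa [ContinuousLinearMap.star_eq_adjoint] using h4
    simp only [Equiv.inv_apply, h3, norm_star]
  · intro x hx h
    have h0 := apply_eq_zero_of_nonneg _ hx _ h
    apply Subtype.ext
    refine ContinuousLinearMap.coe_injective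
      ((EuclideanSpace.basisFun G ℂ).toBasis.ext fun t => ?_)
    ext s
    have := groupVN_entry x s t
    rw [h0] at this
    simpa using this

theorem normTrace_isNSFTrace (I : Type*) [Fintype I] [DecidableEq I] [Nonempty I] :
    IsNSFTrace (fullVN I) normTrace := by
  have hent : ∀ (x : EuclideanSpace ℂ I →L[ℂ] EuclideanSpace ℂ I) (i j : I),
      inner ℂ (EuclideanSpace.single i (1 : ℂ)) (x (EuclideanSpace.single j 1)) =
      x (EuclideanSpace.single j 1) i := fun x i j => by
    simp [EuclideanSpace.inner_single_left]
  have hc : (0 : ℝ) < (Fintype.card I : ℝ)⁻¹ := by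
    have := Fintype.card_pos (α := I)
    positivity
  let f : (EuclideanSpace ℂ I →L[ℂ] EuclideanSpace ℂ I) →ₗ[ℝ] ℝ :=
    (Fintype.card I : ℝ)⁻¹ • ∑ i, vecState (EuclideanSpace.single i (1 : ℂ))
  have hf : ∀ x, f x = (Fintype.card I : ℝ)⁻¹ *
      ∑ i, vecState (EuclideanSpace.single i (1 : ℂ)) x := fun x => by simp [f]
  have hfe : (normTrace : fullVN I → ℝ≥0∞) = fun x : fullVN I =>
      ENNReal.ofReal (f (x : EuclideanSpace ℂ I →L[ℂ] EuclideanSpace ℂ I)) := by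
    funext x
    simp only [hf, normTrace, entry]
    congr 3
    funext i
    rw [← hent]
    rfl
  rw [hfe]
  have hpos : ∀ (x : fullVN I), 0 ≤ x → ∀ i,
      0 ≤ vecState (EuclideanSpace.single i (1 : ℂ)) (x : EuclideanSpace ℂ I →L[ℂ] _) :=
    fun x hx i => re_inner_nonneg _ hx _
  refine isNSFTrace_of_finite (fullVN I) f (fun x hx => ?_) (fun x => ?_) fun x hx h => ?_
  · rw [hf]
    exact mul_nonneg hc.le (Finset.sum_nonneg fun i _ => hpos x hx i)
  · have key : ∀ y : EuclideanSpace ℂ I →L[ℂ] EuclideanSpace ℂ I, f (star y * y) =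
        (Fintype.card I : ℝ)⁻¹ * ∑ i, ∑ j, ‖y (EuclideanSpace.single i 1) j‖ ^ 2 := by
      intro y
      rw [hf]
      congr 1
      refine Finset.sum_congr rfl fun i _ => ?_
      rw [vecState_star_mul, EuclideanSpace.norm_sq_eq]
    have e2 := key (star x : EuclideanSpace ℂ I →L[ℂ] EuclideanSpace ℂ I)
    rw [star_star] at e2
    refine (key x).trans (Eq.trans ?_ e2.symm)
    rw [Finset.sum_comm]
    congr 1
    refine Finset.sum_congr rfl fun i _ => Finset.sum_congr rfl fun j _ => ?_
    rw [← hent, ← hent, ContinuousLinearMap.star_eq_adjoint,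
      ContinuousLinearMap.adjoint_inner_right, norm_inner_symm]
  · rw [hf] at h
    have h1 := (Finset.sum_eq_zero_iff_of_nonneg fun i _ => hpos x hx i).1
      ((mul_eq_zero.1 h).resolve_left hc.ne')
    apply Subtype.ext
    refine ContinuousLinearMap.coe_injective
      ((EuclideanSpace.basisFun I ℂ).toBasis.ext fun t => ?_)
    have h2 := apply_eq_zero_of_nonneg _ hx _ (h1 t (Finset.mem_univ t))
    simpa using h2

end VNDil

end

/-!
The obstruction is the Haagerup--Musat argument. Let `A s t = ∑ₖ conj (φₖ s) φₖ t` with at least two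
`φₖ`, and suppose that the products `conj φₖ φₗ` are linearly independent. In a `*`-algebra with a
faithful finite trace there is no family `(v s)` of unitaries of a corner `p` with Gram matrix `A`
(`false_of_gram_eq`). Indeed, faithfulness turns the factorization of the Gram matrix into
`v s = ∑ₖ φₖ s • wₖ`; comparing coefficients in `v s⋆ * v s = p` gives `wₖ⋆ wₗ = δₖₗ p`; but in a
finite corner an isometry is unitary, so two isometries cannot have orthogonal ranges.

Both negative statements reduce to this. If the Schur multiplier with symbol `A` is `E_J ∘ J'`, then
`J` and `J'` give matrix units `f`, `g` with `τ(g s t * f t s)` equal to `A s t` up to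
normalization. As `A s s = 1`, the diagonal units agree, and `v s = g o s * f s o` are unitaries of
the corner of `f o o` with Gram matrix `A` (`false_of_matrixUnits`). If the Fourier multiplier of `u`
has an absolute dilation, then already `T = E_J U J` gives two unitary representations
`f = J ∘ λ` and `g = U ∘ J ∘ λ` with `τ(g s * f s⁻¹) = u s`, and `v s = g s⁻¹ * f s` has Gram matrix
`u (s * t⁻¹)` (`false_of_unitaryReps`). The trace of the dilating algebra is finite since `J` is
unital and trace preserving, so it extends to a linear functional (`IsNSFTrace.exists_linear`).

The function `u` is the diagonal coefficient, at a unit vector `xi`, of the two-dimensional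
irreducible representation of `S₃` on the vectors of `ℂ³` with coordinate sum zero. Its matrix is
therefore the Gram matrix of the orbit of `xi`, and `φ₁`, `φ₂` are the coordinates of that orbit in
an orthonormal basis (`symbol_mul_inv`). Complete positivity follows because both multipliers
are of the form `x ↦ ∑ₖ Dₖ⋆ x Dₖ` with diagonal `Dₖ`.
-/

noncomputable section

namespace VNDil

/-! ### Finite traces as linear functionals -/

section Trace

variable {H : Type*} [NormedAddCommGroup H] [InnerProductSpace ℂ H] [CompleteSpace H]
  {M : VonNeumannAlgebra H}

theorem star_mul_self_nonneg_of_mem (x : M) : 0 ≤ star x * x :=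
  (star_mul_self_nonneg (x : H →L[ℂ] H) :)

theorem add_nonneg_of_mem {x y : M} (hx : 0 ≤ x) (hy : 0 ≤ y) : 0 ≤ x + y :=
  (add_nonneg (show (0 : H →L[ℂ] H) ≤ x from hx) (show (0 : H →L[ℂ] H) ≤ y from hy) :)

theorem smul_nonneg_of_mem {x : M} (r : ℝ≥0) (hx : 0 ≤ x) : 0 ≤ ((r : ℝ) : ℂ) • x := by
  have hc : (0 : ℂ) ≤ ((r : ℝ) : ℂ) := by exact_mod_cast r.coe_nonneg
  exact (smul_nonneg hc (show (0 : H →L[ℂ] H) ≤ x from hx) :)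

/-- A trace with `τ 1 < ∞` is finite on the whole positive cone, because `x ≤ ‖x‖ • 1`. -/
theorem IsNSFTrace.lt_top {τ : M → ℝ≥0∞} (hτ : IsNSFTrace M τ) (h1 : τ 1 < ∞) {x : M}
    (hx : 0 ≤ x) : τ x < ∞ := by
  have hx' : (0 : H →L[ℂ] H) ≤ x := hx
  let r : ℝ≥0 := ‖(x : H →L[ℂ] H)‖₊
  have hle : (x : H →L[ℂ] H) ≤ ((r : ℝ) : ℂ) • (1 : H →L[ℂ] H) := by
    have h := IsSelfAdjoint.le_algebraMap_norm_self (a := (x : H →L[ℂ] H)) hx'.isSelfAdjoint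
    have h2 : (algebraMap ℝ (H →L[ℂ] H)) ‖(x : H →L[ℂ] H)‖ =
        ((r : ℝ) : ℂ) • (1 : H →L[ℂ] H) := by
      rw [Algebra.algebraMap_eq_smul_one]
      ext v
      simp [r]
    rwa [h2] at h
  have hsub : 0 ≤ ((r : ℝ) : ℂ) • (1 : M) - x := (sub_nonneg.2 hle :)
  have hone : (0 : M) ≤ 1 := by simpa using star_mul_self_nonneg_of_mem (1 : M)
  have h := hτ.map_add x _ hx hsub
  rw [add_sub_cancel, hτ.map_smul r 1 hone] at h
  exact lt_of_le_of_lt (le_self_add.trans h.ge) (ENNReal.mul_lt_top ENNReal.coe_lt_top h1)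

theorem four_smul_star_mul (x y : M) :
    (4 : ℂ) • (star y * x) = (star (x + y) * (x + y) - star (x - y) * (x - y)) +
      Complex.I • (star (x + Complex.I • y) * (x + Complex.I • y) -
        star (x - Complex.I • y) * (x - Complex.I • y)) := by
  simp only [star_add, star_sub, star_smul, add_mul, mul_add, sub_mul, mul_sub, smul_mul_assoc,
    mul_smul_comm, smul_add, smul_sub, smul_smul, Complex.star_def, Complex.conj_I, mul_neg,
    Complex.I_mul_I, neg_neg]
  module

theorem four_smul_mul_star (x y : M) :
    (4 : ℂ) • (x * star y) = ((x + y) * star (x + y) - (x - y) * star (x - y)) +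
      Complex.I • ((x + Complex.I • y) * star (x + Complex.I • y) -
        (x - Complex.I • y) * star (x - Complex.I • y)) := by
  simp only [star_add, star_sub, star_smul, add_mul, mul_add, sub_mul, mul_sub, smul_mul_assoc,
    mul_smul_comm, smul_add, smul_sub, smul_smul, Complex.star_def, Complex.conj_I, mul_neg,
    neg_mul, Complex.I_mul_I, neg_neg]
  module

/-- Polarization of `x = star (star x) * 1` keeps all four pieces in `M` and positive. -/
theorem exists_nonneg_decomposition (x : M) : ∃ a b c d : M, 0 ≤ a ∧ 0 ≤ b ∧ 0 ≤ c ∧ 0 ≤ d ∧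
    x = (a - b) + Complex.I • (c - d) := by
  have h := four_smul_star_mul (1 : M) (star x)
  rw [star_star, mul_one] at h
  have hpos (y : M) : 0 ≤ (((1 / 4 : ℝ≥0) : ℝ) : ℂ) • (star y * y) :=
    smul_nonneg_of_mem _ (star_mul_self_nonneg_of_mem y)
  refine ⟨_, _, _, _, hpos (1 + star x), hpos (1 - star x), hpos (1 + Complex.I • star x),
    hpos (1 - Complex.I • star x), ?_⟩
  have h4 : ((((1 / 4 : ℝ≥0) : ℝ) : ℂ)) = (4 : ℂ)⁻¹ := by push_cast; norm_num
  rw [h4, ← smul_sub, ← smul_sub, smul_comm Complex.I, ← smul_add, ← h, smul_smul]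
  norm_num

/-- A linear functional agreeing with `τ` on the positive cone computes `HasTrace τ`. -/
theorem HasTrace.eq_of_linear {τ : M → ℝ≥0∞} {F : M →ₗ[ℂ] ℂ}
    (hF : ∀ x : M, 0 ≤ x → F x = ((τ x).toReal : ℂ)) {x : M} {z : ℂ} (h : HasTrace τ x z) :
    z = F x := by
  obtain ⟨a, b, c, d, ha, hb, hc, hd, rfl, rfl⟩ := h
  simp [hF a ha.1, hF b hb.1, hF c hc.1, hF d hd.1]

/-- A finite trace extends from the positive cone to a linear functional. -/
theorem IsNSFTrace.exists_linear {τ : M → ℝ≥0∞} (hτ : IsNSFTrace M τ) (h1 : τ 1 < ∞) :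
    ∃ F : M →ₗ[ℂ] ℂ, ∀ x : M, 0 ≤ x → F x = ((τ x).toReal : ℂ) := by
  have hadd {x y : M} (hx : 0 ≤ x) (hy : 0 ≤ y) :
      (τ (x + y)).toReal = (τ x).toReal + (τ y).toReal := by
    rw [hτ.map_add x y hx hy, ENNReal.toReal_add (hτ.lt_top h1 hx).ne (hτ.lt_top h1 hy).ne]
  have hsmul (r : ℝ≥0) {x : M} (hx : 0 ≤ x) :
      (τ (((r : ℝ) : ℂ) • x)).toReal = r * (τ x).toReal := by
    rw [hτ.map_smul r x hx, ENNReal.toReal_mul, ENNReal.coe_toReal]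
  -- the extension to differences of positive elements, as a relation
  let D : M → ℝ → Prop := fun x r => ∃ a b : M, 0 ≤ a ∧ 0 ≤ b ∧ x = a - b ∧
    r = (τ a).toReal - (τ b).toReal
  have Dadd {x y r s} (hx : D x r) (hy : D y s) : D (x + y) (r + s) := by
    obtain ⟨a, b, ha, hb, rfl, rfl⟩ := hx
    obtain ⟨c, d, hc, hd, rfl, rfl⟩ := hy
    refine ⟨a + c, b + d, add_nonneg_of_mem ha hc, add_nonneg_of_mem hb hd, by abel, ?_⟩
    rw [hadd ha hc, hadd hb hd]
    ring
  have Dneg {x r} (hx : D x r) : D (-x) (-r) := by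
    obtain ⟨a, b, ha, hb, rfl, rfl⟩ := hx
    exact ⟨b, a, hb, ha, by abel, by ring⟩
  have Dnn (c : ℝ≥0) {x r} (hx : D x r) : D (((c : ℝ) : ℂ) • x) (c * r) := by
    obtain ⟨a, b, ha, hb, rfl, rfl⟩ := hx
    refine ⟨_, _, smul_nonneg_of_mem c ha, smul_nonneg_of_mem c hb, smul_sub _ _ _, ?_⟩
    rw [hsmul c ha, hsmul c hb]
    ring
  have Dsmul (c : ℝ) {x r} (hx : D x r) : D ((c : ℂ) • x) (c * r) := by
    rcases le_total 0 c with h | h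
    · lift c to ℝ≥0 using h
      exact Dnn c hx
    · obtain ⟨e, rfl⟩ : ∃ e : ℝ≥0, c = -(e : ℝ) := ⟨(-c).toNNReal, by simp [h]⟩
      simpa using Dneg (Dnn e hx)
  have Dstar {x r} (hx : D x r) : star x = x := by
    obtain ⟨a, b, ha, hb, rfl, rfl⟩ := hx
    have hs {a : M} (ha : 0 ≤ a) : star a = a :=
      Subtype.ext (IsSelfAdjoint.of_nonneg (show (0 : H →L[ℂ] H) ≤ a from ha)).star_eq
    rw [star_sub, hs ha, hs hb]
  have Duniq {x r s} (hr : D x r) (hs : D x s) : r = s := by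
    obtain ⟨a, b, ha, hb, rfl, rfl⟩ := hr
    obtain ⟨c, d, hc, hd, h, rfl⟩ := hs
    have h' : a + d = c + b := by
      rw [sub_eq_sub_iff_add_eq_add] at h
      exact h
    have := hadd ha hd
    rw [h', hadd hc hb] at this
    linarith
  -- the extension to all of `M`: real and imaginary parts
  let R : M → ℂ → Prop := fun x z => ∃ a b : M, ∃ r s : ℝ, D a r ∧ D b s ∧
    x = a + Complex.I • b ∧ z = r + Complex.I * s
  have Rtot (x : M) : ∃ z, R x z := by
    obtain ⟨a, b, c, d, ha, hb, hc, hd, rfl⟩ := exists_nonneg_decomposition x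
    exact ⟨_, _, _, _, _, ⟨a, b, ha, hb, rfl, rfl⟩, ⟨c, d, hc, hd, rfl, rfl⟩, rfl, rfl⟩
  have Radd {x y z w} (hx : R x z) (hy : R y w) : R (x + y) (z + w) := by
    obtain ⟨a, b, r, s, h1, h2, rfl, rfl⟩ := hx
    obtain ⟨a', b', r', s', h1', h2', rfl, rfl⟩ := hy
    refine ⟨_, _, _, _, Dadd h1 h1', Dadd h2 h2', ?_, ?_⟩
    · rw [smul_add]
      abel
    · push_cast
      ring
  have Rsmul (c : ℂ) {x z} (hx : R x z) : R (c • x) (c * z) := by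
    obtain ⟨a, b, r, s, h1, h2, rfl, rfl⟩ := hx
    refine ⟨_, _, _, _, Dadd (Dsmul c.re h1) (Dneg (Dsmul c.im h2)),
      Dadd (Dsmul c.im h1) (Dsmul c.re h2), ?_, ?_⟩
    · conv_lhs => rw [← Complex.re_add_im c]
      have hI : Complex.I * Complex.I = -1 := Complex.I_mul_I
      simp only [smul_add, smul_smul, add_smul, add_mul, mul_assoc, hI]
      module
    · conv_lhs => rw [← Complex.re_add_im c]
      push_cast
      linear_combination (c.im * s : ℂ) * Complex.I_mul_I
  have Runiq {x z w} (hz : R x z) (hw : R x w) : z = w := by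
    obtain ⟨a, b, r, s, h1, h2, rfl, rfl⟩ := hz
    obtain ⟨a', b', r', s', h1', h2', h, rfl⟩ := hw
    have hst := congrArg star h
    simp only [star_add, star_smul, Dstar h1, Dstar h2, Dstar h1', Dstar h2', Complex.star_def,
      Complex.conj_I, neg_smul] at hst
    have hI : Complex.I • b = Complex.I • b' := by
      have : (2 : ℂ) • (Complex.I • b) = (2 : ℂ) • (Complex.I • b') := by
        calc (2 : ℂ) • (Complex.I • b) = (a + Complex.I • b) - (a + -(Complex.I • b)) := by module
          _ = (a' + Complex.I • b') - (a' + -(Complex.I • b')) := by rw [h, hst]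
          _ = (2 : ℂ) • (Complex.I • b') := by module
      exact smul_right_injective M two_ne_zero this
    have hb : b = b' := smul_right_injective M Complex.I_ne_zero hI
    subst hb
    have ha : a = a' := add_right_cancel h
    subst ha
    rw [Duniq h1 h1', Duniq h2 h2']
  choose F hF using Rtot
  refine ⟨{ toFun := F, map_add' := fun x y => Runiq (hF _) (Radd (hF x) (hF y)),
            map_smul' := fun c x => Runiq (hF _) (Rsmul c (hF x)) }, fun x hx => ?_⟩
  have D0 : D 0 0 := ⟨0, 0, le_rfl, le_rfl, by simp, by simp⟩
  have hτ0 : (τ 0).toReal = 0 := by simpa using hadd (le_refl (0 : M)) le_rfl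
  exact Runiq (hF x) ⟨x, 0, _, 0, ⟨x, 0, hx, le_rfl, by simp, rfl⟩, D0, by simp, by simp [hτ0]⟩

section

variable {τ : M → ℝ≥0∞} {F : M →ₗ[ℂ] ℂ}

theorem IsNSFTrace.linear_mul_comm (hτ : IsNSFTrace M τ)
    (hF : ∀ x : M, 0 ≤ x → F x = ((τ x).toReal : ℂ)) (x y : M) : F (x * y) = F (y * x) := by
  have hsq (z : M) : F (star z * z) = F (z * star z) := by
    have h := star_mul_self_nonneg_of_mem (star z)
    rw [star_star] at h
    rw [hF _ (star_mul_self_nonneg_of_mem z), hF _ h, hτ.tracial]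
  have h1 := congrArg F (four_smul_star_mul y (star x))
  have h2 := congrArg F (four_smul_mul_star y (star x))
  have hlin (a b c d : M) : F ((a - b) + Complex.I • (c - d)) =
      F a - F b + Complex.I * (F c - F d) := by
    rw [F.map_add, F.map_sub, F.map_smul, F.map_sub, smul_eq_mul]
  rw [hlin, hsq, hsq, hsq, hsq, F.map_smul, star_star] at h1
  rw [hlin, F.map_smul, star_star] at h2
  exact mul_left_cancel₀ four_ne_zero (h1.trans h2.symm)

theorem IsNSFTrace.linear_faithful (hτ : IsNSFTrace M τ) (h1 : τ 1 < ∞)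
    (hF : ∀ x : M, 0 ≤ x → F x = ((τ x).toReal : ℂ)) (x : M) (hx : F (star x * x) = 0) :
    x = 0 := by
  have hpos := star_mul_self_nonneg_of_mem x
  rw [hF _ hpos, Complex.ofReal_eq_zero, ENNReal.toReal_eq_zero_iff] at hx
  have h0 : star x * x = 0 := hτ.faithful _ hpos (hx.resolve_right (hτ.lt_top h1 hpos).ne)
  exact Subtype.ext (CStarRing.star_mul_self_eq_zero_iff _ |>.1 (congrArg Subtype.val h0))

end

end Trace

/-! ### Gram kernels with independent Kraus products -/

/-- A biorthogonal family of functions, for the bilinear pairing. -/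
theorem exists_dual_of_linearIndependent {ι I : Type*} [Fintype ι] [DecidableEq ι] [Fintype I]
    [DecidableEq I] {f : ι → I → ℂ} (hf : LinearIndependent ℂ f) :
    ∃ b : ι → I → ℂ, ∀ i j, ∑ t, b i t * f j t = if i = j then 1 else 0 := by
  obtain ⟨g, hg⟩ := LinearMap.exists_leftInverse_of_injective (Fintype.linearCombination ℂ f)
    (LinearMap.ker_eq_bot.2 hf.fintypeLinearCombination_injective)
  have h (j : ι) : g (f j) = Pi.single j 1 := by
    simpa using LinearMap.congr_fun hg (Pi.single j 1)
  refine ⟨fun i t => g (Pi.single t 1) i, fun i j => ?_⟩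
  have h2 : g (f j) i = ∑ t, g (Pi.single t 1) i * f j t := by
    conv_lhs => rw [pi_eq_sum_univ' (f j)]
    simp only [map_sum, map_smul, Finset.sum_apply, Pi.smul_apply, smul_eq_mul, mul_comm]
  rw [← h2, h, Pi.single_apply]

theorem linearIndependent_of_products {κ I : Type*} [Fintype κ] {φ : κ → I → ℂ}
    (hφ : LinearIndependent ℂ fun (kl : κ × κ) (s : I) => star (φ kl.1 s) * φ kl.2 s) :
    LinearIndependent ℂ φ := by
  classical
  rw [Fintype.linearIndependent_iff] at hφ ⊢
  intro c hc k
  have := hφ (fun kl => if kl.1 = k then c kl.2 else 0) ?_ (k, k)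
  · simpa using this
  · funext s
    have h := congrFun hc s
    simp only [Finset.sum_apply, Pi.smul_apply, smul_eq_mul, Pi.zero_apply] at h ⊢
    rw [Fintype.sum_prod_type, Finset.sum_eq_single k]
    · simp only [if_true]
      rw [← mul_zero (star (φ k s)), ← h, Finset.mul_sum]
      exact Finset.sum_congr rfl fun _ _ => by ring
    · intro b _ hb
      simp [hb]
    · simp

section Abstract

variable {A : Type*} [Ring A] [StarRing A] [Algebra ℂ A] [StarModule ℂ A]
  {κ I : Type*} [Fintype κ] [Fintype I] {φ : κ → I → ℂ}

/-- Unitaries `v i` of the corner of a projection `p`, in an algebra with a faithful finite trace,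
cannot have a Gram matrix whose Kraus products are linearly independent. -/
theorem false_of_gram_eq [Nontrivial κ]
    (hφ : LinearIndependent ℂ fun (kl : κ × κ) (s : I) => star (φ kl.1 s) * φ kl.2 s)
    (tr : A →ₗ[ℂ] ℂ) (hcomm : ∀ x y, tr (x * y) = tr (y * x))
    (hfaith : ∀ x, tr (star x * x) = 0 → x = 0) {p : A} (hp : tr p ≠ 0) {v : I → A}
    (hv : ∀ i, star (v i) * v i = p) (hpv : ∀ i, p * v i = v i) (hvp : ∀ i, v i * p = v i)
    (hgram : ∀ i j, tr (star (v i) * v j) = tr p * ∑ k, star (φ k i) * φ k j) : False := by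
  classical
  obtain ⟨c, hc⟩ := exists_dual_of_linearIndependent (linearIndependent_of_products hφ)
  obtain ⟨b, hb⟩ := exists_dual_of_linearIndependent hφ
  -- a combination of the `v i` vanishes as soon as the same combination of the `φ · i` does
  have hnull (d : I → ℂ) (hd : ∀ k, ∑ i, d i * φ k i = 0) : ∑ i, d i • v i = 0 := by
    apply hfaith
    have h : tr (star (∑ i, d i • v i) * ∑ i, d i • v i) =
        tr p * ∑ k, star (∑ i, d i * φ k i) * ∑ i, d i * φ k i := by
      rw [star_sum, Finset.sum_mul_sum]
      have e (k : κ) : star (∑ i, d i * φ k i) * ∑ i, d i * φ k i =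
          ∑ i, ∑ j, star (d i * φ k i) * (d j * φ k j) := by
        rw [star_sum, Finset.sum_mul_sum]
      simp only [e, star_smul, smul_mul_smul_comm, map_sum, map_smul, hgram, smul_eq_mul,
        Finset.mul_sum, star_mul']
      symm
      rw [Finset.sum_comm]
      refine Finset.sum_congr rfl fun i _ => ?_
      rw [Finset.sum_comm]
      exact Finset.sum_congr rfl fun j _ => Finset.sum_congr rfl fun k _ => by ring
    rw [h]
    simp only [hd, mul_zero, Finset.sum_const_zero]
  let w : κ → A := fun k => ∑ i, c k i • v i
  have hvw (t : I) : v t = ∑ k, φ k t • w k := by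
    have h := hnull (fun i => (if i = t then 1 else 0) - ∑ k, φ k t * c k i) fun l => by
      simp only [sub_mul, Finset.sum_sub_distrib, Finset.sum_mul]
      rw [Finset.sum_comm]
      simp only [mul_assoc, ← Finset.mul_sum, hc]
      simp
    simp only [sub_smul, Finset.sum_sub_distrib, Finset.sum_smul] at h
    rw [Finset.sum_comm, sub_eq_zero] at h
    simp only [ite_smul, one_smul, zero_smul, Finset.sum_ite_eq', Finset.mem_univ, if_true] at h
    rw [h]
    simp only [w, Finset.smul_sum, smul_smul]
  have hnorm (t : I) : ∑ k, star (φ k t) * φ k t = 1 := by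
    have h := hgram t t
    rw [hv] at h
    exact (mul_left_cancel₀ hp (by rw [← h, mul_one]))
  -- comparing the coefficients of the independent products in `v t⋆ * v t = p`
  have hw (k l : κ) : star (w k) * w l = if k = l then p else 0 := by
    have h0 (t : I) : ∑ ij : κ × κ, (star (φ ij.1 t) * φ ij.2 t) •
        (star (w ij.1) * w ij.2 - if ij.1 = ij.2 then p else 0) = 0 := by
      simp only [smul_sub, Finset.sum_sub_distrib]
      have e1 : ∑ ij : κ × κ, (star (φ ij.1 t) * φ ij.2 t) • (star (w ij.1) * w ij.2) = p := by
        rw [← hv t, hvw t, star_sum, Finset.sum_mul_sum, Fintype.sum_prod_type]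
        simp only [star_smul, smul_mul_smul_comm]
      have e2 : ∑ ij : κ × κ, (star (φ ij.1 t) * φ ij.2 t) • (if ij.1 = ij.2 then p else 0) =
          p := by
        rw [Fintype.sum_prod_type]
        simp only [smul_ite, smul_zero, Finset.sum_ite_eq, Finset.mem_univ, if_true,
          ← Finset.sum_smul, hnorm, one_smul]
      rw [e1, e2, sub_self]
    have h1 : ∑ t, b (k, l) t • ∑ ij : κ × κ, (star (φ ij.1 t) * φ ij.2 t) •
        (star (w ij.1) * w ij.2 - if ij.1 = ij.2 then p else 0) = 0 := by
      simp only [h0, smul_zero, Finset.sum_const_zero]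
    simp only [Finset.smul_sum, smul_smul] at h1
    rw [Finset.sum_comm] at h1
    simp only [← Finset.sum_smul, hb, ite_smul, one_smul, zero_smul, Finset.sum_ite_eq,
      Finset.mem_univ, if_true] at h1
    exact sub_eq_zero.1 h1
  have hpw (k : κ) : p * w k = w k := by simp [w, Finset.mul_sum, hpv]
  have hwp (k : κ) : w k * p = w k := by simp [w, Finset.sum_mul, hvp]
  obtain ⟨k, l, hkl⟩ := exists_pair_ne κ
  have hpstar : star p = p := by
    have h := hw k k
    rw [if_pos rfl] at h
    rw [← h]
    simp
  have hpp : p * p = p := by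
    have h := hw k k
    rw [if_pos rfl] at h
    calc p * p = star (w k) * (w k * p) := by rw [← mul_assoc, h]
      _ = p := by rw [hwp, h]
  have hwk : star (w k) * w k = p := by simpa using hw k k
  have hsw : star (w k) * p = star (w k) := by
    rw [← hpstar, ← star_mul, hpw]
  -- the trace forces the isometry `w k` of the corner of `p` to be unitary
  have hq : p - w k * star (w k) = 0 := by
    apply hfaith
    have : star (p - w k * star (w k)) * (p - w k * star (w k)) = p - w k * star (w k) := by
      have e1 : p * (w k * star (w k)) = w k * star (w k) := by rw [← mul_assoc, hpw]
      have e2 : w k * star (w k) * p = w k * star (w k) := by rw [mul_assoc, hsw]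
      have e3 : w k * star (w k) * (w k * star (w k)) = w k * star (w k) := by
        rw [mul_assoc, ← mul_assoc (star (w k)), hwk, ← mul_assoc, hwp]
      simp only [star_sub, star_mul, star_star, hpstar, sub_mul, mul_sub, hpp, e1, e2, e3]
      abel
    rw [this, map_sub, hcomm, hwk, sub_self]
  have hl : w l = 0 := by
    rw [← hpw l, sub_eq_zero.1 hq, mul_assoc, hw, if_neg hkl, mul_zero]
  have := hw l l
  rw [hl, if_pos rfl, mul_zero] at this
  exact hp (by rw [← this, map_zero])

end Abstract

section Algebraic

variable {A : Type*} [Ring A] [StarRing A] [Algebra ℂ A] [StarModule ℂ A]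
  {κ I : Type*} [Fintype κ] [Fintype I] {φ : κ → I → ℂ}

/-- Two systems of matrix units have no mixed traces `τ(g s t * f t s)` proportional to a Gram
kernel with ones on the diagonal and linearly independent Kraus products. -/
theorem false_of_matrixUnits [Nontrivial κ] [Nonempty I]
    (hφ : LinearIndependent ℂ fun (kl : κ × κ) (s : I) => star (φ kl.1 s) * φ kl.2 s)
    (tr : A →ₗ[ℂ] ℂ) (hcomm : ∀ x y, tr (x * y) = tr (y * x))
    (hfaith : ∀ x, tr (star x * x) = 0 → x = 0) {f g : I → I → A}
    (hf : ∀ i j k, f i j * f j k = f i k) (hg : ∀ i j k, g i j * g j k = g i k)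
    (hf' : ∀ i j, star (f i j) = f j i) (hg' : ∀ i j, star (g i j) = g j i)
    {c : ℂ} (hc : c ≠ 0) (hftr : ∀ i, tr (f i i) = c) (hgtr : ∀ i, tr (g i i) = c)
    (hφ1 : ∀ i, ∑ k, star (φ k i) * φ k i = 1)
    (hgf : ∀ s t, tr (g s t * f t s) = c * ∑ k, star (φ k s) * φ k t) : False := by
  have hdiag (i : I) : g i i = f i i := by
    -- `τ((g - f)²) = τ(g) - 2 τ(g f) + τ(f)` vanishes for the two projections
    rw [← sub_eq_zero]
    apply hfaith
    have e : star (g i i - f i i) * (g i i - f i i) =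
        g i i - g i i * f i i - (f i i * g i i - f i i) := by
      rw [star_sub, hg', hf', sub_mul, mul_sub, mul_sub, hg, hf]
    rw [e, map_sub, map_sub, map_sub, hcomm (f i i), hgf, hftr, hgtr, hφ1]
    ring
  obtain ⟨o⟩ := ‹Nonempty I›
  have hstar (s : I) : star (g o s * f s o) = f o s * g s o := by rw [star_mul, hf', hg']
  refine false_of_gram_eq hφ tr hcomm hfaith (p := f o o) (v := fun s => g o s * f s o)
    (by rwa [hftr]) (fun s => ?_) (fun s => ?_) (fun s => ?_) (fun s t => ?_)
  · rw [hstar, mul_assoc, ← mul_assoc (g s o), hg, hdiag, hf, hf]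
  · rw [← hdiag, ← mul_assoc, hg]
  · rw [mul_assoc, hf]
  · rw [hstar, mul_assoc, ← mul_assoc (g s o), hg, hcomm, mul_assoc, hf, hgf, hftr]

/-- Two unitary representations of a group have no mixed traces `τ(g s * f s⁻¹)` that form a
Gram kernel in `(s, t) ↦ s * t⁻¹` with linearly independent Kraus products. -/
theorem false_of_unitaryReps {G : Type*} [Group G] [Fintype G] {φ : κ → G → ℂ} [Nontrivial κ]
    (hφ : LinearIndependent ℂ fun (kl : κ × κ) (s : G) => star (φ kl.1 s) * φ kl.2 s)
    (tr : A →ₗ[ℂ] ℂ) (hcomm : ∀ x y, tr (x * y) = tr (y * x))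
    (hfaith : ∀ x, tr (star x * x) = 0 → x = 0) (h1 : tr 1 = 1) {f g : G → A}
    (hf : ∀ s t, f s * f t = f (s * t)) (hg : ∀ s t, g s * g t = g (s * t))
    (hf1 : f 1 = 1) (hg1 : g 1 = 1)
    (hf' : ∀ s, star (f s) = f s⁻¹) (hg' : ∀ s, star (g s) = g s⁻¹)
    (hgf : ∀ s t, tr (g (s * t⁻¹) * f (t * s⁻¹)) = ∑ k, star (φ k s) * φ k t) : False := by
  have hstar (s : G) : star (g s⁻¹ * f s) = f s⁻¹ * g s := by rw [star_mul, hf', hg', inv_inv]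
  refine false_of_gram_eq hφ tr hcomm hfaith (p := 1) (v := fun s => g s⁻¹ * f s)
    (by simp [h1]) (fun s => ?_) (fun s => one_mul _) (fun s => mul_one _) (fun s t => ?_)
  · rw [hstar, mul_assoc, ← mul_assoc (g s), hg, mul_inv_cancel, hg1, one_mul, hf, inv_mul_cancel,
      hf1]
  · rw [hstar, h1, one_mul, ← hgf, mul_assoc, ← mul_assoc (g s), hg, hcomm, mul_assoc, hf]

end Algebraic

/-! ### The trace identities of a dilation -/

section Trace

variable {H : Type*} [NormedAddCommGroup H] [InnerProductSpace ℂ H] [CompleteSpace H]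
  {K : Type*} [NormedAddCommGroup K] [InnerProductSpace ℂ K] [CompleteSpace K]
  {M : VonNeumannAlgebra H} {N : VonNeumannAlgebra K}

theorem linearMap_ext_of_star_mul_self {F G : M →ₗ[ℂ] ℂ}
    (h : ∀ x : M, F (star x * x) = G (star x * x)) : F = G := by
  ext x
  have key := four_smul_star_mul (1 : M) (star x)
  rw [star_star, mul_one] at key
  have hF (F : M →ₗ[ℂ] ℂ) (a b c d : M) : F ((a - b) + Complex.I • (c - d)) =
      F a - F b + Complex.I * (F c - F d) := by
    rw [F.map_add, F.map_sub, F.map_smul, F.map_sub, smul_eq_mul]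
  have : F ((4 : ℂ) • x) = G ((4 : ℂ) • x) := by
    rw [key, hF F, hF G, h, h, h, h]
  rw [F.map_smul, G.map_smul] at this
  exact smul_right_injective ℂ (four_ne_zero (α := ℂ)) this

variable {τ : M → ℝ≥0∞} {σ : N → ℝ≥0∞} {F : M →ₗ[ℂ] ℂ} {G : N →ₗ[ℂ] ℂ}

theorem TracePreserving.linear_eq {J : M →⋆ₐ[ℂ] N} (hJ : TracePreserving τ σ J)
    (hF : ∀ x : M, 0 ≤ x → F x = ((τ x).toReal : ℂ))
    (hG : ∀ x : N, 0 ≤ x → G x = ((σ x).toReal : ℂ)) (x : M) : G (J x) = F x := by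
  have : G ∘ₗ J.toAlgHom.toLinearMap = F := linearMap_ext_of_star_mul_self fun x => by
    have h1 : J (star x * x) = star (J x) * J x := by rw [map_mul, map_star]
    change G (J (star x * x)) = _
    rw [hF _ (star_mul_self_nonneg_of_mem x), ← hJ _ (star_mul_self_nonneg_of_mem x), ← hG, h1]
    rw [h1]
    exact star_mul_self_nonneg_of_mem _
  exact LinearMap.congr_fun this x

/-- The defining identity of `E_J`, for the linear extensions of two finite traces. -/
theorem IsCondExp.linear_eq {J : M →⋆ₐ[ℂ] N} {E : N →ₗ[ℂ] M} (hE : IsCondExp τ σ J E)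
    (hτ : ∀ x : M, 0 ≤ x → τ x < ∞)
    (hF : ∀ x : M, 0 ≤ x → F x = ((τ x).toReal : ℂ))
    (hG : ∀ x : N, 0 ≤ x → G x = ((σ x).toReal : ℂ)) (y : N) (x : M) :
    F (E y * x) = G (y * J x) := by
  have : F ∘ₗ LinearMap.mulLeft ℂ (E y) =
      G ∘ₗ LinearMap.mulLeft ℂ y ∘ₗ J.toAlgHom.toLinearMap :=
    linearMap_ext_of_star_mul_self fun x => by
      obtain ⟨z, h1, h2⟩ := hE y (star x * x) (star_mul_self_nonneg_of_mem x)
        (hτ _ (star_mul_self_nonneg_of_mem x))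
      exact (h1.eq_of_linear hF).symm.trans (h2.eq_of_linear hG)
  exact LinearMap.congr_fun this x

end Trace

/-! ### Operators on a finite-dimensional Hilbert space with a basis -/

section Finite

variable {I : Type*} [Fintype I] [DecidableEq I]

/-- The operator on `ℓ²_I` with a given matrix. -/
def ofMatrix (a : Matrix I I ℂ) : fullVN I := ⟨Matrix.toEuclideanCLM (𝕜 := ℂ) a, trivial⟩

theorem entry_ofMatrix (a : Matrix I I ℂ) (i j : I) : entry (ofMatrix a) i j = a i j := by
  simp [entry, ofMatrix]

theorem toEuclideanCLM_single_apply (a : Matrix I I ℂ) (i j : I) :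
    Matrix.toEuclideanCLM (𝕜 := ℂ) a (EuclideanSpace.single j 1) i = a i j := by
  simp

theorem ofMatrix_entry (x : fullVN I) : ofMatrix (Matrix.of (entry x)) = x := by
  obtain ⟨a, ha : Matrix.toEuclideanCLM (𝕜 := ℂ) a = _⟩ :=
    (Matrix.toEuclideanCLM (n := I) (𝕜 := ℂ)).surjective
    (x : EuclideanSpace ℂ I →L[ℂ] EuclideanSpace ℂ I)
  obtain rfl : ofMatrix a = x := Subtype.ext ha
  congr 1
  ext i j
  exact entry_ofMatrix a i j

theorem ofMatrix_mul (a b : Matrix I I ℂ) : ofMatrix (a * b) = ofMatrix a * ofMatrix b :=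
  Subtype.ext (map_mul _ a b)

theorem ofMatrix_star (a : Matrix I I ℂ) : ofMatrix (star a) = star (ofMatrix a) :=
  Subtype.ext (map_star _ a)

theorem entry_ext {x y : fullVN I} (h : ∀ i j, entry x i j = entry y i j) : x = y := by
  rw [← ofMatrix_entry x, ← ofMatrix_entry y]
  congr 1
  ext i j
  exact h i j

theorem inner_apply_eq_sum (x : EuclideanSpace ℂ I →L[ℂ] EuclideanSpace ℂ I)
    (ξ η : EuclideanSpace ℂ I) : inner ℂ ξ (x η) =
      ∑ s, ∑ t, star (ξ s) * x (EuclideanSpace.single t 1) s * η t := by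
  have h : η = ∑ t, η t • EuclideanSpace.single t (1 : ℂ) := by
    ext t
    simp [Finset.sum_apply, Pi.single_apply]
  conv_lhs => rw [h]
  simp only [map_sum, map_smul, PiLp.inner_apply]
  refine Finset.sum_congr rfl fun s _ => ?_
  simp [Finset.sum_mul]
  refine Finset.sum_congr rfl fun t _ => ?_
  ring

theorem summable_inner_apply {K : Type*} [NormedAddCommGroup K] [InnerProductSpace ℂ K]
    (a : K →L[ℂ] K) (ξ η : lp (fun _ : ℕ => K) 2) :
    Summable fun n => inner ℂ (ξ n) (a (η n)) := by
  have hs (ξ : lp (fun _ : ℕ => K) 2) : Summable fun n => ‖ξ n‖ ^ 2 := by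
    simpa using (memℓp_gen_iff (p := 2) (by norm_num)).1 (lp.memℓp ξ)
  refine Summable.of_norm_bounded (((hs ξ).add (hs η)).mul_left ‖a‖) fun n => ?_
  calc ‖inner ℂ (ξ n) (a (η n))‖ ≤ ‖ξ n‖ * (‖a‖ * ‖η n‖) :=
        (norm_inner_le_norm _ _).trans (by gcongr; exact a.le_opNorm _)
    _ ≤ ‖a‖ * (‖ξ n‖ ^ 2 + ‖η n‖ ^ 2) := by
        nlinarith [mul_nonneg (norm_nonneg a) (sq_nonneg (‖ξ n‖ - ‖η n‖)),
          mul_nonneg (norm_nonneg a) (add_nonneg (sq_nonneg ‖ξ n‖) (sq_nonneg ‖η n‖))]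

theorem continuous_entry (M : VonNeumannAlgebra (EuclideanSpace ℂ I)) (s t : I) :
    @Continuous M ℂ (sigmaWeak M) _ fun x =>
      (x : EuclideanSpace ℂ I →L[ℂ] EuclideanSpace ℂ I) (EuclideanSpace.single t 1) s := by
  let ξ (s : I) : lp (fun _ : ℕ => EuclideanSpace ℂ I) 2 :=
    lp.single 2 0 (EuclideanSpace.single s (1 : ℂ))
  have h : (fun x : M => (x : EuclideanSpace ℂ I →L[ℂ] EuclideanSpace ℂ I)
      (EuclideanSpace.single t 1) s) =
      fun x : M => ∑' n, inner ℂ (ξ s n) ((x : EuclideanSpace ℂ I →L[ℂ] _) (ξ t n)) := by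
    funext x
    rw [tsum_eq_single 0]
    · simp [ξ, EuclideanSpace.inner_single_left]
    · intro n hn
      simp [ξ, lp.single_apply, hn]
  rw [h]
  exact continuous_iInf_dom (i := ξ s) (continuous_iInf_dom (i := ξ t) continuous_induced_dom)

/-- A linear functional on a von Neumann algebra acting on `ℓ²_I`, `I` finite, is `σ`-weakly
continuous: it is a combination of matrix entries. -/
theorem continuous_linear_sigmaWeak {M : VonNeumannAlgebra (EuclideanSpace ℂ I)} (L : M →ₗ[ℂ] ℂ) :
    @Continuous M ℂ (sigmaWeak M) _ L := by
  let incl : M →ₗ[ℂ] (EuclideanSpace ℂ I →L[ℂ] EuclideanSpace ℂ I) :=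
    { toFun := Subtype.val, map_add' := fun _ _ => rfl, map_smul' := fun _ _ => rfl }
  obtain ⟨g, hg⟩ := LinearMap.exists_leftInverse_of_injective incl
    (LinearMap.ker_eq_bot.2 Subtype.val_injective)
  have h (x : M) : L x = ∑ s, ∑ t, (x : EuclideanSpace ℂ I →L[ℂ] EuclideanSpace ℂ I)
      (EuclideanSpace.single t 1) s *
        L (g (Matrix.toEuclideanCLM (𝕜 := ℂ) (Matrix.single s t 1))) := by
    have e : (x : EuclideanSpace ℂ I →L[ℂ] EuclideanSpace ℂ I) = ∑ s, ∑ t,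
        (x : EuclideanSpace ℂ I →L[ℂ] EuclideanSpace ℂ I) (EuclideanSpace.single t 1) s •
          Matrix.toEuclideanCLM (𝕜 := ℂ) (Matrix.single s t 1) := by
      obtain ⟨a, ha : Matrix.toEuclideanCLM (𝕜 := ℂ) a = _⟩ :=
    (Matrix.toEuclideanCLM (n := I) (𝕜 := ℂ)).surjective
        (x : EuclideanSpace ℂ I →L[ℂ] EuclideanSpace ℂ I)
      rw [← ha]
      simp only [toEuclideanCLM_single_apply]
      conv_lhs => rw [Matrix.matrix_eq_sum_single a]
      simp only [map_sum, ← map_smul, Matrix.smul_single, smul_eq_mul, mul_one]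
    have hgx : g x = x := LinearMap.congr_fun hg x
    conv_lhs => rw [← hgx, e]
    simp only [map_sum, map_smul, smul_eq_mul]
  have h' : (L : M → ℂ) = _ := funext h
  rw [h']
  have key {X : Type _} [TopologicalSpace X] {f : I → I → X → ℂ} (hf : ∀ s t, Continuous (f s t))
      (c : I → I → ℂ) : Continuous fun x => ∑ s, ∑ t, f s t x * c s t := by fun_prop
  exact @key M (sigmaWeak M) _ (continuous_entry M) _

/-- Every linear map out of a von Neumann algebra acting on a finite-dimensional space is normal. -/
theorem isNormalMap_of_finite {K : Type*} [NormedAddCommGroup K] [InnerProductSpace ℂ K]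
    [CompleteSpace K] {M : VonNeumannAlgebra (EuclideanSpace ℂ I)} {N : VonNeumannAlgebra K}
    (T : M →ₗ[ℂ] N) : IsNormalMap T := by
  refine continuous_iInf_rng.2 fun ξ => continuous_iInf_rng.2 fun η => continuous_induced_rng.2 ?_
  let L : N →ₗ[ℂ] ℂ :=
    { toFun := fun x => ∑' n, inner ℂ (ξ n) ((x : K →L[ℂ] K) (η n))
      map_add' := fun x y => by
        rw [← (summable_inner_apply _ ξ η).tsum_add (summable_inner_apply _ ξ η)]
        simp
      map_smul' := fun c x => by
        simp [tsum_mul_left] }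
  exact continuous_linear_sigmaWeak (L ∘ₗ T)

/-- A unital map which multiplies matrix entries by a Gram kernel `∑ₖ conj (φₖ s) φₖ t`
is completely positive: it is `x ↦ ∑ₖ Dₖ⋆ x Dₖ`, where `Dₖ` is the diagonal operator of `φₖ`. -/
theorem isUCP_of_entries {κ : Type*} [Fintype κ] {φ : κ → I → ℂ}
    {M N : VonNeumannAlgebra (EuclideanSpace ℂ I)} {T : M →ₗ[ℂ] N}
    (hT : ∀ (x : M) (s t : I),
      (T x : EuclideanSpace ℂ I →L[ℂ] EuclideanSpace ℂ I) (EuclideanSpace.single t 1) s =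
      (∑ k, star (φ k s) * φ k t) *
        (x : EuclideanSpace ℂ I →L[ℂ] EuclideanSpace ℂ I) (EuclideanSpace.single t 1) s)
    (hT1 : T 1 = 1) : IsUCP T := by
  refine ⟨hT1, fun n x hx ξ => ?_⟩
  let D (k : κ) (ξ : EuclideanSpace ℂ I) : EuclideanSpace ℂ I := WithLp.toLp 2 fun s => φ k s * ξ s
  have h (x : M) (ξ η : EuclideanSpace ℂ I) :
      inner ℂ ξ ((T x : EuclideanSpace ℂ I →L[ℂ] EuclideanSpace ℂ I) η) =
      ∑ k, inner ℂ (D k ξ) ((x : EuclideanSpace ℂ I →L[ℂ] EuclideanSpace ℂ I) (D k η)) := by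
    simp only [inner_apply_eq_sum, hT]
    rw [Finset.sum_comm (s := Finset.univ (α := κ))]
    refine Finset.sum_congr rfl fun s _ => ?_
    rw [Finset.sum_comm (s := Finset.univ (α := κ))]
    refine Finset.sum_congr rfl fun t _ => ?_
    simp only [D, star_mul', Finset.mul_sum, Finset.sum_mul]
    exact Finset.sum_congr rfl fun k _ => by ring
  simp only [Matrix.map_apply, h]
  have e : ∑ i, ∑ j, ∑ k, inner ℂ (D k (ξ i))
      ((x i j : EuclideanSpace ℂ I →L[ℂ] EuclideanSpace ℂ I) (D k (ξ j))) =
      ∑ k, ∑ i, ∑ j, inner ℂ (D k (ξ i))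
      ((x i j : EuclideanSpace ℂ I →L[ℂ] EuclideanSpace ℂ I) (D k (ξ j))) := by
    simp only [Finset.sum_comm (s := Finset.univ (α := κ))]
  rw [e]
  exact Finset.sum_nonneg fun k _ => hx fun i => D k (ξ i)

end Finite

/-! ### Schur multipliers -/

section Schur

variable {I : Type*} [Fintype I] [DecidableEq I]

theorem ofMatrix_one : ofMatrix (1 : Matrix I I ℂ) = 1 := Subtype.ext (map_one _)

theorem entry_add (x y : fullVN I) (i j : I) : entry (x + y) i j = entry x i j + entry y i j :=
  rfl

theorem entry_smul (c : ℂ) (x : fullVN I) (i j : I) : entry (c • x) i j = c * entry x i j := rfl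

theorem entry_one (i j : I) : entry (1 : fullVN I) i j = if i = j then 1 else 0 := by
  rw [← ofMatrix_one, entry_ofMatrix, Matrix.one_apply]

/-- The matrix unit `e_{ij}` of `B(ℓ²_I)`. -/
def matrixUnit (i j : I) : fullVN I := ofMatrix (Matrix.single i j 1)

theorem matrixUnit_mul (i j k : I) : matrixUnit i j * matrixUnit j k = matrixUnit i k := by
  rw [matrixUnit, matrixUnit, ← ofMatrix_mul, Matrix.single_mul_single_same, mul_one, matrixUnit]

theorem star_matrixUnit (i j : I) : star (matrixUnit i j) = matrixUnit j i := by
  rw [matrixUnit, ← ofMatrix_star, Matrix.star_eq_conjTranspose, Matrix.conjTranspose_single,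
    star_one, matrixUnit]

theorem entry_matrixUnit (i j s t : I) :
    entry (matrixUnit i j) s t = if i = s ∧ j = t then 1 else 0 := by
  rw [matrixUnit, entry_ofMatrix, Matrix.single_apply]

/-- The diagonal entries of a positive operator are nonnegative reals. -/
theorem apply_single_self_of_nonneg {x : EuclideanSpace ℂ I →L[ℂ] EuclideanSpace ℂ I} (hx : 0 ≤ x)
    (i : I) : 0 ≤ (x (EuclideanSpace.single i 1) i).re ∧
      x (EuclideanSpace.single i 1) i = ((x (EuclideanSpace.single i 1) i).re : ℂ) := by
  have h := ((ContinuousLinearMap.nonneg_iff_isPositive x).1 hx).inner_nonneg_right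
    (EuclideanSpace.single i 1)
  rw [EuclideanSpace.inner_single_left, map_one, one_mul, Complex.nonneg_iff] at h
  exact ⟨h.1, Complex.ext rfl (by simpa using h.2.symm)⟩

variable (I) in
/-- The normalized trace of `B(ℓ²_I)` as a linear functional. -/
def normTraceLinear : fullVN I →ₗ[ℂ] ℂ where
  toFun x := (Fintype.card I : ℂ)⁻¹ * ∑ i, entry x i i
  map_add' x y := by simp only [entry_add, Finset.sum_add_distrib, mul_add]
  map_smul' c x := by
    simp only [entry_smul, ← Finset.mul_sum, smul_eq_mul, RingHom.id_apply]
    ring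

theorem normTraceLinear_of_nonneg (x : fullVN I) (hx : 0 ≤ x) :
    normTraceLinear I x = ((normTrace x).toReal : ℂ) := by
  have h := apply_single_self_of_nonneg (x := (x : EuclideanSpace ℂ I →L[ℂ] EuclideanSpace ℂ I)) hx
  rw [normTrace, ENNReal.toReal_ofReal]
  · push_cast
    exact congrArg ((Fintype.card I : ℂ)⁻¹ * ·) (Finset.sum_congr rfl fun i _ => (h i).2)
  · exact mul_nonneg (by positivity) (Finset.sum_nonneg fun i _ => (h i).1)

theorem normTraceLinear_matrixUnit (i : I) :
    normTraceLinear I (matrixUnit i i) = (Fintype.card I : ℂ)⁻¹ := by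
  change _ * ∑ j, entry (matrixUnit i i) j j = _
  simp [entry_matrixUnit]

theorem existsUnique_isSchurMultiplier (ψ : I → I → ℂ) : ∃! T, IsSchurMultiplier ψ T := by
  refine ⟨{ toFun := fun x => ofMatrix (Matrix.of fun i j => ψ i j * entry x i j)
            map_add' := fun x y => entry_ext fun i j => ?_
            map_smul' := fun c x => entry_ext fun i j => ?_ }, fun x i j => ?_, fun T hT => ?_⟩
  · simp only [entry_add, entry_ofMatrix, Matrix.of_apply, mul_add]
  · simp only [entry_smul, entry_ofMatrix, Matrix.of_apply, RingHom.id_apply]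
    ring
  · exact entry_ofMatrix _ i j
  · ext1 x
    refine entry_ext fun i j => ?_
    rw [hT]
    exact (entry_ofMatrix (Matrix.of fun i j => ψ i j * entry x i j) i j).symm

namespace IsSchurMultiplier

variable {ψ : I → I → ℂ} {T : fullVN I →ₗ[ℂ] fullVN I}

theorem map_matrixUnit (hT : IsSchurMultiplier ψ T) (i j : I) :
    T (matrixUnit i j) = ψ i j • matrixUnit i j := by
  refine entry_ext fun s t => ?_
  rw [hT, entry_smul, entry_matrixUnit]
  split_ifs with h
  · rw [h.1, h.2]
  · simp

theorem map_one (hT : IsSchurMultiplier ψ T) (hψ : ∀ i, ψ i i = 1) : T 1 = 1 := by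
  refine entry_ext fun s t => ?_
  rw [hT, entry_one]
  split_ifs with h
  · rw [h, hψ, one_mul]
  · simp

theorem tracePreserving (hT : IsSchurMultiplier ψ T) (hψ : ∀ i, ψ i i = 1) :
    TracePreserving normTrace normTrace T := fun x _ => by
  simp only [normTrace, hT x, hψ, one_mul]

variable {κ : Type*} [Fintype κ] {φ : κ → I → ℂ}

theorem isUCP (hT : IsSchurMultiplier (fun s t => ∑ k, star (φ k s) * φ k t) T)
    (hφ1 : ∀ i, ∑ k, star (φ k i) * φ k i = 1) : IsUCP T :=
  isUCP_of_entries hT (hT.map_one hφ1)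

/-- A Schur multiplier whose Gram kernel has linearly independent Kraus products is not
factorizable: `T = E_J ∘ J'` makes the images of the matrix units under `J` and `J'` two systems
of matrix units with the mixed traces `τ(T(e_{st}) e_{ts})`. -/
theorem not_factorizable [Nonempty I] [Nontrivial κ]
    (hφ : LinearIndependent ℂ fun (kl : κ × κ) (s : I) => star (φ kl.1 s) * φ kl.2 s)
    (hφ1 : ∀ i, ∑ k, star (φ k i) * φ k i = 1)
    (hT : IsSchurMultiplier (fun s t => ∑ k, star (φ k s) * φ k t) T) :
    ¬ Factorizable.{w} normTrace T := by
  rintro ⟨K, _, _, _, N, σ, J, J', E, hσ, -, hJ, -, hJ', hE, hTE⟩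
  have hone : (0 : fullVN I) ≤ 1 := by simpa using star_mul_self_nonneg_of_mem (1 : fullVN I)
  have hσ1 : σ 1 < ∞ := by
    rw [← _root_.map_one J, hJ 1 hone]
    exact ENNReal.ofReal_lt_top
  obtain ⟨G, hG⟩ := hσ.exists_linear hσ1
  have hF := normTraceLinear_of_nonneg (I := I)
  refine false_of_matrixUnits hφ G (hσ.linear_mul_comm hG) (hσ.linear_faithful hσ1 hG)
    (f := fun i j => J (matrixUnit i j)) (g := fun i j => J' (matrixUnit i j))
    (c := (Fintype.card I : ℂ)⁻¹) (fun i j k => ?_) (fun i j k => ?_) (fun i j => ?_)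
    (fun i j => ?_) (by simp) (fun i => ?_) (fun i => ?_) hφ1 (fun s t => ?_)
  · rw [← map_mul, matrixUnit_mul]
  · rw [← map_mul, matrixUnit_mul]
  · rw [← map_star, star_matrixUnit]
  · rw [← map_star, star_matrixUnit]
  · rw [hJ.linear_eq hF hG, normTraceLinear_matrixUnit]
  · rw [hJ'.linear_eq hF hG, normTraceLinear_matrixUnit]
  · rw [← hE.linear_eq (fun _ _ => ENNReal.ofReal_lt_top) hF hG, ← hTE, hT.map_matrixUnit,
      smul_mul_assoc, LinearMap.map_smul, matrixUnit_mul, normTraceLinear_matrixUnit, smul_eq_mul,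
      mul_comm]

end IsSchurMultiplier

end Schur

/-! ### Fourier multipliers -/

section Fourier

variable {G : Type*} [Group G] [Fintype G]

theorem lam_mul (s t : G) : lam G s * lam G t = lam G (s * t) := by
  apply Subtype.ext
  ext h i
  change leftReg G s (leftReg G t h) i = _
  rw [leftReg_apply, leftReg_apply]
  change _ = leftReg G (s * t) h i
  rw [leftReg_apply, mul_inv_rev, mul_assoc]

theorem lam_one : lam G 1 = 1 := by
  apply Subtype.ext
  ext h i
  change leftReg G 1 h i = h i
  rw [leftReg_apply, inv_one, one_mul]

theorem star_lam (s : G) : star (lam G s) = lam G s⁻¹ := by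
  apply Subtype.ext
  change star (leftReg G s) = leftReg G s⁻¹
  rw [ContinuousLinearMap.star_eq_adjoint]
  symm
  rw [ContinuousLinearMap.eq_adjoint_iff]
  intro a b
  simp only [PiLp.inner_apply, leftReg_apply]
  refine Fintype.sum_equiv (Equiv.mulLeft s) _ _ fun i => ?_
  simp

variable [DecidableEq G]

theorem lam_apply_single (g s t : G) :
    ((lam G g : groupVN G) : EuclideanSpace ℂ G →L[ℂ] EuclideanSpace ℂ G)
      (EuclideanSpace.single t 1) s = if g = s * t⁻¹ then 1 else 0 := by
  change leftReg G g _ s = _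
  rw [leftReg_apply, PiLp.single_apply]
  refine if_congr ?_ rfl rfl
  rw [inv_mul_eq_iff_eq_mul, eq_mul_inv_iff_mul_eq, eq_comm]

/-- The coefficient of `λ(g)` in an element of `VN(G)`, `G` finite. -/
def coeff (g : G) : groupVN G →ₗ[ℂ] ℂ where
  toFun x := (x : EuclideanSpace ℂ G →L[ℂ] EuclideanSpace ℂ G) (EuclideanSpace.single 1 1) g
  map_add' _ _ := rfl
  map_smul' _ _ := rfl

theorem coeff_lam (g s : G) : coeff g (lam G s) = if s = g then 1 else 0 := by
  refine (lam_apply_single s g 1).trans ?_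
  simp

theorem groupVN_ext {x y : groupVN G} (h : ∀ g, coeff g x = coeff g y) : x = y := by
  apply Subtype.ext
  refine ContinuousLinearMap.coe_injective
    ((EuclideanSpace.basisFun G ℂ).toBasis.ext fun t => ?_)
  ext s
  have h1 := groupVN_entry x s t
  have h2 := groupVN_entry y s t
  simpa using h1.trans ((h (s * t⁻¹)).trans h2.symm)

theorem sum_coeff_smul_lam (x : groupVN G) : ∑ g, coeff g x • lam G g = x := by
  refine groupVN_ext fun g => ?_
  rw [map_sum]
  simp only [map_smul, coeff_lam, smul_eq_mul, mul_ite, mul_one, mul_zero]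
  simp

theorem coeff_one_of_nonneg (x : groupVN G) (hx : 0 ≤ x) :
    coeff 1 x = ((plancherel G x).toReal : ℂ) := by
  have h := apply_single_self_of_nonneg (x := (x : EuclideanSpace ℂ G →L[ℂ] EuclideanSpace ℂ G)) hx 1
  rw [plancherel, EuclideanSpace.inner_single_left, map_one, one_mul, ENNReal.toReal_ofReal h.1]
  exact h.2

theorem existsUnique_isFourierMultiplier (u : G → ℂ) : ∃! T, IsFourierMultiplier u T := by
  refine ⟨∑ g, (coeff g).smulRight (u g • lam G g), ⟨isNormalMap_of_finite _, fun t => ?_⟩,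
    fun T hT => ?_⟩
  · simp [LinearMap.sum_apply, coeff_lam]
  · ext1 x
    conv_lhs => rw [← sum_coeff_smul_lam x]
    rw [map_sum, LinearMap.sum_apply]
    refine Finset.sum_congr rfl fun g _ => ?_
    rw [T.map_smul, hT.apply_lam, LinearMap.smulRight_apply]

namespace IsFourierMultiplier

variable {u : G → ℂ} {T : groupVN G →ₗ[ℂ] groupVN G}

theorem coeff_map (hT : IsFourierMultiplier u T) (x : groupVN G) (g : G) :
    coeff g (T x) = u g * coeff g x := by
  conv_lhs => rw [← sum_coeff_smul_lam x]
  rw [map_sum, map_sum]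
  have (i : G) : coeff g (T (coeff i x • lam G i)) = if i = g then u g * coeff g x else 0 := by
    rw [T.map_smul, hT.apply_lam, LinearMap.map_smul, LinearMap.map_smul, coeff_lam]
    split_ifs with h
    · subst h
      simp [mul_comm]
    · simp
  rw [Finset.sum_congr rfl fun i _ => this i, Finset.sum_ite_eq', if_pos (Finset.mem_univ g)]

variable {κ : Type*} [Fintype κ] {φ : κ → G → ℂ}

theorem isUCP (hT : IsFourierMultiplier u T) (hu1 : u 1 = 1)
    (hu : ∀ s t, u (s * t⁻¹) = ∑ k, star (φ k s) * φ k t) : IsUCP T := by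
  refine isUCP_of_entries (φ := φ) (fun x s t => ?_) ?_
  · rw [groupVN_entry, groupVN_entry x, ← hu]
    exact hT.coeff_map x _
  · rw [← lam_one, hT.apply_lam, hu1, one_smul]

/-- Only `T = E_J U J`, the case `k = 1` of an absolute dilation, is used: the unitaries
`J(λ(s))` and `U(J(λ(s)))` have the mixed traces `τ(T(λ(s)) λ(t))`. -/
theorem not_absolutelyDilatable [Nontrivial κ] (hT : IsFourierMultiplier u T)
    (hφ : LinearIndependent ℂ fun (kl : κ × κ) (s : G) => star (φ kl.1 s) * φ kl.2 s)
    (hu : ∀ s t, u (s * t⁻¹) = ∑ k, star (φ k s) * φ k t) :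
    ¬ AbsolutelyDilatable.{w} (plancherel G) T := by
  rintro ⟨K, _, _, _, N, σ, J, U, E, hσ, -, hJ, -, hE, hTE⟩
  have hone : (0 : groupVN G) ≤ 1 := by simpa using star_mul_self_nonneg_of_mem (1 : groupVN G)
  have hσ1 : σ 1 < ∞ := by
    rw [← map_one J, hJ 1 hone]
    exact ENNReal.ofReal_lt_top
  obtain ⟨tr, htr⟩ := hσ.exists_linear hσ1
  have hF := coeff_one_of_nonneg (G := G)
  have hTE1 (x : groupVN G) : T x = E (U (J x)) := hTE 1 x
  refine false_of_unitaryReps hφ tr (hσ.linear_mul_comm htr) (hσ.linear_faithful hσ1 htr) ?_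
    (f := fun s => J (lam G s)) (g := fun s => U (J (lam G s))) (fun s t => ?_) (fun s t => ?_)
    ?_ ?_ (fun s => ?_) (fun s => ?_) (fun s t => ?_)
  · rw [← map_one J, hJ.linear_eq hF htr, ← lam_one, coeff_lam, if_pos rfl]
  · rw [← map_mul, lam_mul]
  · rw [← map_mul, ← map_mul, lam_mul]
  · rw [lam_one, map_one]
  · rw [lam_one, map_one, map_one]
  · rw [← map_star, star_lam]
  · rw [← map_star, ← map_star, star_lam]
  · rw [← hE.linear_eq (fun _ _ => ENNReal.ofReal_lt_top) hF htr, ← hTE1, hT.apply_lam,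
      smul_mul_assoc, LinearMap.map_smul, lam_mul, coeff_lam, ← hu, if_pos (by group), smul_eq_mul,
      mul_one]

end IsFourierMultiplier

end Fourier

/-! ### The explicit function on the symmetric group -/

/-- The kernel is the matrix `Bᴴ * B`, where `B` has the `φ k` as rows. -/
theorem rank_gram {κ I : Type*} [Fintype κ] [Fintype I] {φ : κ → I → ℂ}
    (hφ : LinearIndependent ℂ φ) :
    (Matrix.of fun s t : I => ∑ k, star (φ k s) * φ k t).rank = Fintype.card κ := by
  have h : (Matrix.of fun s t : I => ∑ k, star (φ k s) * φ k t) =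
      (Matrix.of φ).conjTranspose * Matrix.of φ := by
    ext s t
    simp [Matrix.mul_apply]
  rw [h, Matrix.rank_conjTranspose_mul_self]
  exact LinearIndependent.rank_matrix (M := Matrix.of φ) hφ

/-- Half of the first coordinate of `xi`. -/
def xiRe : ℝ := (√2 + 1) / 6

/-- The imaginary part of the last coordinate of `xi`. -/
def xiIm : ℝ := (√2 - 1) * √3 / 6

/-- A unit vector of `ℂ³` with coordinate sum zero. In the orthonormal basis
`(2, -1, -1) / √6`, `(0, 1, -1) / √2` of that plane its coordinates are `(√2 + 1) / √6` and
`-i (√2 - 1) / √6`: their moduli give the prescribed value at `(23)`, their relative phase gives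
equal values at `(12)` and `(31)`, and the sign gives the orientation of the values at the
3-cycles. -/
def xi : Fin 3 → ℂ := ![2 * xiRe, -xiRe - xiIm * Complex.I, -xiRe + xiIm * Complex.I]

theorem xi_zero : xi 0 = 2 * xiRe := rfl

theorem xi_one : xi 1 = -xiRe - xiIm * Complex.I := rfl

theorem xi_two : xi 2 = -xiRe + xiIm * Complex.I := rfl

theorem star_xi_zero : star (xi 0) = 2 * xiRe := by simp [xi_zero]

theorem star_xi_one : star (xi 1) = -xiRe + xiIm * Complex.I := by simp [xi_one]

theorem star_xi_two : star (xi 2) = -xiRe - xiIm * Complex.I := by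
  simp [xi_two, sub_eq_add_neg]

theorem xiRe_sq : (xiRe : ℂ) ^ 2 = (3 + 2 * (√2 : ℝ)) / 36 := by
  have h := Real.sq_sqrt (by norm_num : (0 : ℝ) ≤ 2)
  have : xiRe ^ 2 = (3 + 2 * √2) / 36 := by
    rw [xiRe]
    linear_combination h / 36
  exact_mod_cast this

theorem xiIm_sq : (xiIm : ℂ) ^ 2 = (3 - 2 * (√2 : ℝ)) / 12 := by
  have h := Real.sq_sqrt (by norm_num : (0 : ℝ) ≤ 2)
  have h3 := Real.sq_sqrt (by norm_num : (0 : ℝ) ≤ 3)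
  have : xiIm ^ 2 = (3 - 2 * √2) / 12 := by
    rw [xiIm]
    linear_combination h / 12 + (√2 - 1) ^ 2 / 36 * h3
  exact_mod_cast this

theorem xiRe_mul_xiIm : (xiRe : ℂ) * xiIm = (√3 : ℝ) / 36 := by
  have h := Real.sq_sqrt (by norm_num : (0 : ℝ) ≤ 2)
  have : xiRe * xiIm = √3 / 36 := by
    rw [xiRe, xiIm]
    linear_combination √3 / 36 * h
  exact_mod_cast this

/-- The coefficient `g ↦ ⟪ξ, ξ ∘ g⁻¹⟫` of the permutation representation at `ξ = xi`. -/
def symbol (g : Perm (Fin 3)) : ℂ := ∑ j, star (xi j) * xi (g⁻¹ j)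

/-- The coordinates of `xi ∘ t` in the orthonormal basis `(2, -1, -1) / √6`, `(0, 1, -1) / √2`
of the plane of coordinate sum zero; the first is simplified by means of `xi_comp_sum`. -/
def kraus (k : Fin 2) (t : Perm (Fin 3)) : ℂ :=
  if k = 0 then √3 / √2 * xi (t 0) else (xi (t 1) - xi (t 2)) / √2

theorem sqrt_two_sq : ((√2 : ℝ) : ℂ) ^ 2 = 2 := by
  exact_mod_cast Real.sq_sqrt (by norm_num : (0 : ℝ) ≤ 2)

theorem sqrt_three_sq : ((√3 : ℝ) : ℂ) ^ 2 = 3 := by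
  exact_mod_cast Real.sq_sqrt (by norm_num : (0 : ℝ) ≤ 3)

theorem sqrt_two_ne_zero : ((√2 : ℝ) : ℂ) ≠ 0 := by
  simp

theorem xi_comp_sum (t : Perm (Fin 3)) : xi (t 0) + xi (t 1) + xi (t 2) = 0 := by
  have h : ∑ i, xi (t i) = ∑ i, xi i := Equiv.sum_comp t xi
  rw [Fin.sum_univ_three, Fin.sum_univ_three] at h
  rw [h]
  rw [xi_zero, xi_one, xi_two]
  ring

theorem kraus_zero_zero (s t : Perm (Fin 3)) : star (kraus 0 s) * kraus 0 t =
    3 / 2 * (star (xi (s 0)) * xi (t 0)) := by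
  simp only [kraus, if_true, star_mul', star_div₀, Complex.star_def, Complex.conj_ofReal]
  field_simp
  rw [sqrt_two_sq, sqrt_three_sq]
  ring

theorem kraus_one_one (s t : Perm (Fin 3)) : star (kraus 1 s) * kraus 1 t =
    1 / 2 * ((star (xi (s 1)) - star (xi (s 2))) * (xi (t 1) - xi (t 2))) := by
  simp only [kraus, one_ne_zero, if_false, star_sub, star_div₀, Complex.star_def,
    Complex.conj_ofReal]
  field_simp
  rw [sqrt_two_sq]
  ring

theorem kraus_zero_one (s t : Perm (Fin 3)) : star (kraus 0 s) * kraus 1 t =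
    (√3 : ℝ) / 2 * (star (xi (s 0)) * (xi (t 1) - xi (t 2))) := by
  simp only [kraus, one_ne_zero, if_true, if_false, star_mul', star_div₀, Complex.star_def,
    Complex.conj_ofReal]
  field_simp
  rw [sqrt_two_sq]
  ring

theorem kraus_one_zero (s t : Perm (Fin 3)) : star (kraus 1 s) * kraus 0 t =
    (√3 : ℝ) / 2 * ((star (xi (s 1)) - star (xi (s 2))) * xi (t 0)) := by
  simp only [kraus, one_ne_zero, if_true, if_false, star_sub, star_div₀, Complex.star_def,
    Complex.conj_ofReal]
  field_simp
  rw [sqrt_two_sq]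
  ring

theorem symbol_mul_inv (s t : Perm (Fin 3)) :
    symbol (s * t⁻¹) = ∑ k, star (kraus k s) * kraus k t := by
  have h1 : symbol (s * t⁻¹) = ∑ i, star (xi (s i)) * xi (t i) := by
    rw [symbol, ← Equiv.sum_comp s]
    simp
  have hs := congrArg star (xi_comp_sum s)
  have ht := xi_comp_sum t
  rw [star_add, star_add, star_zero] at hs
  rw [h1, Fin.sum_univ_three, Fin.sum_univ_two, kraus_zero_zero, kraus_one_one]
  have hs0 : star (xi (s 0)) = -star (xi (s 1)) - star (xi (s 2)) := by linear_combination hs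
  have ht0 : xi (t 0) = -xi (t 1) - xi (t 2) := by linear_combination ht
  rw [hs0, ht0]
  ring

theorem symbol_one : symbol 1 = 1 := by
  simp only [symbol, inv_one, Perm.one_apply]
  rw [Fin.sum_univ_three, star_xi_zero, star_xi_one, star_xi_two, xi_zero, xi_one, xi_two]
  linear_combination 6 * xiRe_sq + 2 * xiIm_sq - 2 * xiIm ^ 2 * Complex.I_sq

theorem symbol_rotation : symbol c[0, 1, 2] = -1 / 2 + Complex.I / (2 * (√3 : ℝ)) := by
  have e : (c[0, 1, 2] : Perm (Fin 3))⁻¹ = (c[0, 2, 1] : Perm (Fin 3)) := by decide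
  have e0 : (c[0, 2, 1] : Perm (Fin 3)) 0 = 2 := by decide
  have e1 : (c[0, 2, 1] : Perm (Fin 3)) 1 = 0 := by decide
  have e2 : (c[0, 2, 1] : Perm (Fin 3)) 2 = 1 := by decide
  rw [symbol, e, Fin.sum_univ_three, e0, e1, e2, star_xi_zero, star_xi_one, star_xi_two, xi_zero,
    xi_one, xi_two]
  have h3 : Complex.I / (2 * (√3 : ℝ)) = Complex.I * (√3 : ℝ) / 6 := by
    have : ((√3 : ℝ) : ℂ) ≠ 0 := by simp
    field_simp
    rw [sqrt_three_sq]
    ring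
  rw [h3]
  linear_combination -3 * xiRe_sq - xiIm_sq + 6 * Complex.I * xiRe_mul_xiIm + xiIm ^ 2 * Complex.I_sq

theorem symbol_rotation_inv : symbol c[0, 2, 1] = -1 / 2 - Complex.I / (2 * (√3 : ℝ)) := by
  have e : (c[0, 2, 1] : Perm (Fin 3))⁻¹ = (c[0, 1, 2] : Perm (Fin 3)) := by decide
  have e0 : (c[0, 1, 2] : Perm (Fin 3)) 0 = 1 := by decide
  have e1 : (c[0, 1, 2] : Perm (Fin 3)) 1 = 2 := by decide
  have e2 : (c[0, 1, 2] : Perm (Fin 3)) 2 = 0 := by decide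
  rw [symbol, e, Fin.sum_univ_three, e0, e1, e2, star_xi_zero, star_xi_one, star_xi_two, xi_zero,
    xi_one, xi_two]
  have h3 : Complex.I / (2 * (√3 : ℝ)) = Complex.I * (√3 : ℝ) / 6 := by
    have : ((√3 : ℝ) : ℂ) ≠ 0 := by simp
    field_simp
    rw [sqrt_three_sq]
    ring
  rw [h3]
  linear_combination -3 * xiRe_sq - xiIm_sq - 6 * Complex.I * xiRe_mul_xiIm + xiIm ^ 2 * Complex.I_sq

theorem symbol_swap_zero_one : symbol (Equiv.swap 0 1) = -((√2 : ℝ) : ℂ) / 3 := by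
  have e : ((Equiv.swap 0 1) : Perm (Fin 3))⁻¹ = (Equiv.swap 0 1 : Perm (Fin 3)) := by decide
  have e0 : (Equiv.swap 0 1 : Perm (Fin 3)) 0 = 1 := by decide
  have e1 : (Equiv.swap 0 1 : Perm (Fin 3)) 1 = 0 := by decide
  have e2 : (Equiv.swap 0 1 : Perm (Fin 3)) 2 = 2 := by decide
  rw [symbol, e, Fin.sum_univ_three, e0, e1, e2, star_xi_zero, star_xi_one, star_xi_two, xi_zero,
    xi_one, xi_two]
  linear_combination -3 * xiRe_sq + xiIm_sq - xiIm ^ 2 * Complex.I_sq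

theorem symbol_swap_one_two : symbol (Equiv.swap 1 2) = 2 * ((√2 : ℝ) : ℂ) / 3 := by
  have e : ((Equiv.swap 1 2) : Perm (Fin 3))⁻¹ = (Equiv.swap 1 2 : Perm (Fin 3)) := by decide
  have e0 : (Equiv.swap 1 2 : Perm (Fin 3)) 0 = 0 := by decide
  have e1 : (Equiv.swap 1 2 : Perm (Fin 3)) 1 = 2 := by decide
  have e2 : (Equiv.swap 1 2 : Perm (Fin 3)) 2 = 1 := by decide
  rw [symbol, e, Fin.sum_univ_three, e0, e1, e2, star_xi_zero, star_xi_one, star_xi_two, xi_zero,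
    xi_one, xi_two]
  linear_combination 6 * xiRe_sq - 2 * xiIm_sq + 2 * xiIm ^ 2 * Complex.I_sq

theorem symbol_swap_two_zero : symbol (Equiv.swap 2 0) = -((√2 : ℝ) : ℂ) / 3 := by
  have e : ((Equiv.swap 2 0) : Perm (Fin 3))⁻¹ = (Equiv.swap 2 0 : Perm (Fin 3)) := by decide
  have e0 : (Equiv.swap 2 0 : Perm (Fin 3)) 0 = 2 := by decide
  have e1 : (Equiv.swap 2 0 : Perm (Fin 3)) 1 = 1 := by decide
  have e2 : (Equiv.swap 2 0 : Perm (Fin 3)) 2 = 0 := by decide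
  rw [symbol, e, Fin.sum_univ_three, e0, e1, e2, star_xi_zero, star_xi_one, star_xi_two, xi_zero,
    xi_one, xi_two]
  linear_combination -3 * xiRe_sq + xiIm_sq - xiIm ^ 2 * Complex.I_sq

theorem linearIndependent_kraus :
    LinearIndependent ℂ fun (kl : Fin 2 × Fin 2) (s : Perm (Fin 3)) =>
      star (kraus kl.1 s) * kraus kl.2 s := by
  rw [Fintype.linearIndependent_iff]
  intro c hc
  have h (t : Perm (Fin 3)) := congrFun hc t
  simp only [Fintype.sum_prod_type, Fin.sum_univ_two, Pi.add_apply, Pi.smul_apply, smul_eq_mul,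
    Pi.zero_apply] at h
  -- `t` and `t * (23)` give the same `kraus 0` and opposite `kraus 1`, so that sums and differences
  -- of two equations separate the diagonal from the off-diagonal coefficients
  have a1 := h 1
  have a2 := h (Equiv.swap 1 2)
  have a3 := h (Equiv.swap 0 1)
  have a4 := h (Equiv.swap 0 1 * Equiv.swap 1 2)
  have e1 (i : Fin 3) : (1 : Perm (Fin 3)) i = i := rfl
  have e2 : (Equiv.swap 1 2 : Perm (Fin 3)) 0 = 0 ∧ (Equiv.swap 1 2 : Perm (Fin 3)) 1 = 2 ∧
    (Equiv.swap 1 2 : Perm (Fin 3)) 2 = 1 := by decide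
  have e3 : (Equiv.swap 0 1 : Perm (Fin 3)) 0 = 1 ∧ (Equiv.swap 0 1 : Perm (Fin 3)) 1 = 0 ∧
    (Equiv.swap 0 1 : Perm (Fin 3)) 2 = 2 := by decide
  have e4 : (Equiv.swap 0 1 * Equiv.swap 1 2 : Perm (Fin 3)) 0 = 1 ∧
    (Equiv.swap 0 1 * Equiv.swap 1 2 : Perm (Fin 3)) 1 = 2 ∧
    (Equiv.swap 0 1 * Equiv.swap 1 2 : Perm (Fin 3)) 2 = 0 := by decide
  rw [kraus_zero_zero, kraus_one_one, kraus_zero_one, kraus_one_zero] at a1 a2 a3 a4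
  simp only [e1, e2.1, e2.2.1, e2.2.2, e3.1, e3.2.1, e3.2.2, e4.1, e4.2.1, e4.2.2]
    at a1 a2 a3 a4
  simp only [star_xi_zero, star_xi_one, star_xi_two] at a1 a2 a3 a4
  simp only [xi_zero, xi_one, xi_two] at a1 a2 a3 a4
  have hr := xiRe_sq
  have hm := xiIm_sq
  have hrm := xiRe_mul_xiIm
  have hI := Complex.I_sq
  have h2 := sqrt_two_ne_zero
  have h3 : ((√3 : ℝ) : ℂ) ≠ 0 := by simp
  have b1 : c (0, 0) * (3 + 2 * (√2 : ℝ)) + c (1, 1) * (3 - 2 * (√2 : ℝ)) = 0 := by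
    linear_combination 3 * (a1 + a2) - 36 * c (0, 0) * hr - 12 * c (1, 1) * hm
      + 12 * c (1, 1) * xiIm ^ 2 * hI
  have b2 : c (0, 0) * (3 - (√2 : ℝ)) + c (1, 1) * (3 + (√2 : ℝ)) = 0 := by
    linear_combination 3 * (a3 + a4) - 9 * c (0, 0) * (hr + hm) - c (1, 1) * (27 * hr + 3 * hm)
      + (9 * c (0, 0) + 3 * c (1, 1)) * xiIm ^ 2 * hI
  have b3 : c (0, 1) = c (1, 0) := by
    have : (c (0, 1) - c (1, 0)) * (Complex.I * (√3 : ℝ) ^ 2) = 0 := by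
      linear_combination -9 * (a1 - a2) - 36 * (√3 : ℝ) * Complex.I * (c (0, 1) - c (1, 0)) * hrm
    rcases mul_eq_zero.1 this with h | h
    · exact sub_eq_zero.1 h
    · exact absurd h (mul_ne_zero Complex.I_ne_zero (pow_ne_zero 2 h3))
  have b4 : c (1, 0) = 0 := by
    have : c (1, 0) * ((√3 : ℝ) * (√2 : ℝ)) = 0 := by
      rw [b3] at a3 a4
      linear_combination -(3 / 2) * (a3 - a4) - 9 * (√3 : ℝ) * c (1, 0) * hr
        + 3 * (√3 : ℝ) * c (1, 0) * hm - 3 * (√3 : ℝ) * c (1, 0) * xiIm ^ 2 * hI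
    exact (mul_eq_zero.1 this).resolve_right (mul_ne_zero h3 h2)
  have b5 : c (1, 1) = 0 := by
    have : c (1, 1) * (√2 : ℝ) = 0 := by
      linear_combination ((3 + 2 * (√2 : ℝ)) * b2 - (3 - (√2 : ℝ)) * b1) / 18
    exact (mul_eq_zero.1 this).resolve_right h2
  have b6 : c (0, 0) = 0 := by
    have : c (0, 0) * (√2 : ℝ) = 0 := by
      linear_combination ((3 + (√2 : ℝ)) * b1 - (3 - 2 * (√2 : ℝ)) * b2) / 18
    exact (mul_eq_zero.1 this).resolve_right h2
  rintro ⟨i, j⟩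
  fin_cases i <;> fin_cases j
  exacts [b6, b3.trans b4, b4, b5]

end VNDil

end

theorem theorem5p3 :
    ∃ u : Perm (Fin 3) → ℂ,
      -- the explicit function; `0, 1, 2` stand for the points usually called `1, 2, 3`
      (u 1 = 1 ∧
        u c[0, 1, 2] = -1 / 2 + Complex.I / (2 * (√3 : ℝ)) ∧
        u c[0, 2, 1] = -1 / 2 - Complex.I / (2 * (√3 : ℝ)) ∧
        u (Equiv.swap 0 1) = -((√2 : ℝ) : ℂ) / 3 ∧
        u (Equiv.swap 1 2) = 2 * ((√2 : ℝ) : ℂ) / 3 ∧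
        u (Equiv.swap 2 0) = -((√2 : ℝ) : ℂ) / 3) ∧
      -- `M_u` is a well-defined Fourier multiplier, ucp, without absolute dilation
      (∃! T, VNDil.IsFourierMultiplier u T) ∧
      (∀ T, VNDil.IsFourierMultiplier u T →
        VNDil.IsUCP T ∧ ¬ VNDil.AbsolutelyDilatable.{w, 0} (VNDil.plancherel (Perm (Fin 3))) T) ∧
      -- the `6 × 6` Herz–Schur matrix has rank 2 and linearly independent Kraus products
      (Matrix.of fun s t : Perm (Fin 3) => u (s * t⁻¹)).rank = 2 ∧
      (∃ φ : Fin 2 → Perm (Fin 3) → ℂ,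
        (∀ s t, u (s * t⁻¹) = ∑ k, star (φ k s) * φ k t) ∧
        LinearIndependent ℂ
          fun (kl : Fin 2 × Fin 2) (s : Perm (Fin 3)) => star (φ kl.1 s) * φ kl.2 s) ∧
      -- the associated Schur multiplier is normal, ucp, trace preserving and not factorizable
      (∃! T, VNDil.IsSchurMultiplier (fun s t => u (s * t⁻¹)) T) ∧
      (∀ T, VNDil.IsSchurMultiplier (fun s t => u (s * t⁻¹)) T →
        VNDil.IsNormalMap T ∧ VNDil.IsUCP T ∧
        VNDil.TracePreserving VNDil.normTrace VNDil.normTrace T ∧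
        ¬ VNDil.Factorizable.{w, 0} VNDil.normTrace T) := by
  have hli := VNDil.linearIndependent_kraus
  have hu := VNDil.symbol_mul_inv
  have hS : (fun s t => VNDil.symbol (s * t⁻¹)) =
      fun s t => ∑ k, star (VNDil.kraus k s) * VNDil.kraus k t :=
    funext fun s => funext fun t => hu s t
  have h1 (s : Perm (Fin 3)) : ∑ k, star (VNDil.kraus k s) * VNDil.kraus k s = 1 := by
    rw [← hu, mul_inv_cancel, VNDil.symbol_one]
  refine ⟨VNDil.symbol, ⟨VNDil.symbol_one, VNDil.symbol_rotation, VNDil.symbol_rotation_inv,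
    VNDil.symbol_swap_zero_one, VNDil.symbol_swap_one_two, VNDil.symbol_swap_two_zero⟩,
    VNDil.existsUnique_isFourierMultiplier _,
    fun T hT => ⟨hT.isUCP VNDil.symbol_one hu, hT.not_absolutelyDilatable hli hu⟩, ?_,
    ⟨VNDil.kraus, hu, hli⟩, VNDil.existsUnique_isSchurMultiplier _, ?_⟩
  · rw [hS, VNDil.rank_gram (VNDil.linearIndependent_of_products hli), Fintype.card_fin]
  · rw [hS]
    exact fun T hT => ⟨VNDil.isNormalMap_of_finite T, hT.isUCP h1, hT.tracePreserving h1,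
      hT.not_factorizable hli h1⟩
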